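/- A digraph $D$ may have loops and antiparallel or parallel edges. The distance $d(x,y)\in\mathbb N\cup\{\infty\}$ is the length of a shortest directed path from $x$ to $y$ ($\infty$ if there is none), $\mathcal B^+_r(x)=\{y: d(x,y)\le r\}$ and $\mathcal B^-_r(x)=\{y: d(y,x)\le r\}$; the out-ball (in-ball) of radius $r$ around a path is the union of the out-balls (in-balls) of radius $r$ around its vertices. $D$ is locally finite if all in- and out-degrees are finite. A geodesic is a directed path from $x$ to $y$ of length $d(x,y)$. $D$ is hyperbolic if there is a $\delta\ge 0$ such that for any three vertices $a,b,c$, any geodesic $P$ from $a$ to $b$, any geodesic $Q$ between $a$ and $c$ and any geodesic $R$ between $b$ and $c$ (the last two in either direction), $P$ is contained in the union of the out-ball of radius $\delta$ around $Q$ and the in-ball of radius $\delta$ around $R$. Consider the properties (B1) there is a function $f$ such that for all $x$, $r\ge 0$ and $y,z\in\mathcal B^+_r(x)$ either $d(y,z)=\infty$ or $d(y,z)\le f(r)$; (B2) the same with $\mathcal B^-_r(x)$ in place of $\mathcal B^+_r(x)$. $D$ has a finite base if there is a finite vertex set $S$ such that every vertex $x$ satisfies $\min\{d(x,s),d(s,x)\}<\infty$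 for some $s\in S$. A ray is a sequence $x_0x_1\ldots$ of distinct vertices with edges $x_ix_{i+1}$, an anti-ray one with edges $x_{i+1}x_i$. For rays or anti-rays write $R_1\preccurlyeq R_2$ if there are infinitely many pairwise disjoint directed $R_1$-$R_2$ paths; the ends of $D$ are the equivalence classes of $R_1\preccurlyeq R_2\preccurlyeq R_1$ on all rays and anti-rays. $D$ is one-ended if it has exactly one end. A ray or anti-ray is quasi-geodesic if for some $\gamma\ge 1$, $c\ge 0$ each of its finite directed subpaths, from $u$ to $v$ say, has length at most $\gamma d(u,v)+c$. For quasi-geodesic rays or anti-rays write $R_1\le R_2$ if there is an $M\ge 0$ such that for every $r\ge 0$ and every vertex $x$ there is a directed $R_1$-$R_2$ path of length at most $M$ outside of $\mathcal B^+_r(x)\cup\mathcal B^-_r(x)$. The quasi-geodesic boundary $\partial D$ is the set of equivalence classes of $R_1\le R_2\le R_1$ on the quasi-geodesic rays and anti-rays. **Theorem.** (i) Let $D$ be a one-ended locally finite hyperbolic digraph that satisfies (B1) and (B2) and has a finite base. Then $\partial D$ has either exactly one or infinitely many elements. (ii) Let $S$ be a finitely generated right cancellative semigroup that is hyperbolic,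 i.e. for some finite generating set the right Cayley digraph (edges from $x$ to $xa$ for all $x\in S$ and all generators $a$) is hyperbolic. Let $A$ be any finite generating set of $S$ and suppose that the right Cayley digraph $\mathrm{Cay}(S,A)$ is one-ended. Then the quasi-geodesic boundary $\partial S=\partial\,\mathrm{Cay}(S,A)$ has either exactly one or infinitely many elements. -/

import Mathlib

/-! Digraphs are Mathlib's `Digraph V`: an arbitrary (loops and antiparallel edges allowed) adjacency
relation.  Parallel edges play no role for any of the notions below, since all of them (paths, rays,
distances, degrees, geodesics, ends, boundary) only refer to vertices and adjacency.
Distances in a digraph are natural numbers or infinite, so radii and additive or multiplicative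
constants are taken to be natural numbers. -/

namespace DigraphBoundary

variable {V : Type*}

/-- A (finite) directed path `x₀ x₁ … xₙ` with `n = length`; vertices may be repeated.
The values `vert i` for `i > length` are irrelevant. -/
structure DiPath (D : Digraph V) where
  length : ℕ
  vert : ℕ → V
  adj : ∀ i < length, D.Adj (vert i) (vert (i + 1))

namespace DiPath

variable {D : Digraph V}

/-- The starting vertex. -/
def first (P : DiPath D) : V := P.vert 0

/-- The end vertex. -/
def last (P : DiPath D) : V := P.vert P.length

/-- The set of vertices on the path. -/
def support (P : DiPath D) : Set V := P.vert '' Set.Iic P.length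

end DiPath

/-- The distance from `x` to `y`: the length of a shortest directed path from `x` to `y`,
and `⊤` if there is none. -/
noncomputable def dist (D : Digraph V) (x y : V) : ℕ∞ :=
  ⨅ (P : DiPath D) (_ : P.first = x ∧ P.last = y), (P.length : ℕ∞)

/-- The out-ball of radius `r` around `x`. -/
def outBall (D : Digraph V) (x : V) (r : ℕ) : Set V := {y | dist D x y ≤ r}

/-- The in-ball of radius `r` around `x`. -/
def inBall (D : Digraph V) (x : V) (r : ℕ) : Set V := {y | dist D y x ≤ r}

/-- All in- and out-degrees are finite. -/
def IsLocallyFinite (D : Digraph V) : Prop :=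
  ∀ x, {y | dist D x y = 1}.Finite ∧ {y | dist D y x = 1}.Finite

/-- A geodesic is a directed path whose length is the distance from its first to its last vertex. -/
def DiPath.IsGeodesic {D : Digraph V} (P : DiPath D) : Prop :=
  (P.length : ℕ∞) = dist D P.first P.last

/-- `P` is a geodesic between `a` and `b`, in one of the two possible directions. -/
def DiPath.IsGeodesicBetween {D : Digraph V} (P : DiPath D) (a b : V) : Prop :=
  P.IsGeodesic ∧ ((P.first = a ∧ P.last = b) ∨ (P.first = b ∧ P.last = a))

/-- All geodesic triangles are `δ`-thin.  The three sides join `a, b` and `a, c` and `b, c`, each one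
in an arbitrary direction; by symmetry the side `P` under consideration is directed from `a` to `b`.
It has to lie in the union of the out-ball of radius `δ` around the side at its starting vertex and
the in-ball of radius `δ` around the side at its end vertex. -/
def IsDeltaHyperbolic (D : Digraph V) (δ : ℕ) : Prop :=
  ∀ (a b c : V) (P Q R : DiPath D),
    P.IsGeodesic → P.first = a → P.last = b →
    Q.IsGeodesicBetween a c → R.IsGeodesicBetween b c →
    P.support ⊆ (⋃ q ∈ Q.support, outBall D q δ) ∪ (⋃ q ∈ R.support, inBall D q δ)

/-- Hyperbolicity in the sense of Gray and Kambites. -/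
def IsHyperbolic (D : Digraph V) : Prop := ∃ δ : ℕ, IsDeltaHyperbolic D δ

/-- Property (B1): finite distances inside out-balls of radius `r` are bounded by `f r`. -/
def BoundedOutBalls (D : Digraph V) : Prop :=
  ∃ f : ℕ → ℕ, ∀ (x : V) (r : ℕ), ∀ y ∈ outBall D x r, ∀ z ∈ outBall D x r,
    dist D y z = ⊤ ∨ dist D y z ≤ f r

/-- Property (B2): finite distances inside in-balls of radius `r` are bounded by `f r`. -/
def BoundedInBalls (D : Digraph V) : Prop :=
  ∃ f : ℕ → ℕ, ∀ (x : V) (r : ℕ), ∀ y ∈ inBall D x r, ∀ z ∈ inBall D x r,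
    dist D y z = ⊤ ∨ dist D y z ≤ f r

/-- There is a finite base: a finite vertex set `S` such that every vertex has finite distance
to or from some element of `S`. -/
def IsFinitelyBased (D : Digraph V) : Prop :=
  ∃ S : Set V, S.Finite ∧ ∀ x, ∃ s ∈ S, min (dist D x s) (dist D s x) < ⊤

/-- A ray: distinct vertices `x₀, x₁, …` with an edge from each `xᵢ` to `xᵢ₊₁`. -/
structure Ray (D : Digraph V) where
  vert : ℕ → V
  inj : Function.Injective vert
  adj : ∀ i, D.Adj (vert i) (vert (i + 1))

/-- An anti-ray: distinct vertices `x₀, x₁, …` with an edge from each `xᵢ₊₁` to `xᵢ`. -/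
structure AntiRay (D : Digraph V) where
  vert : ℕ → V
  inj : Function.Injective vert
  adj : ∀ i, D.Adj (vert (i + 1)) (vert i)

/-- The rays and anti-rays of a digraph. -/
abbrev RayOrAntiRay (D : Digraph V) := Ray D ⊕ AntiRay D

/-- The vertex set of a ray or anti-ray. -/
def RayOrAntiRay.support {D : Digraph V} : RayOrAntiRay D → Set V
  | .inl R => Set.range R.vert
  | .inr R => Set.range R.vert

/-- Quasi-geodesic rays and anti-rays: for some `γ ≥ 1` and `c ≥ 0`, every finite directed subpath,
from `u` to `v` say, has length at most `γ d(u,v) + c`. -/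
def RayOrAntiRay.IsQuasiGeodesic {D : Digraph V} : RayOrAntiRay D → Prop
  | .inl R => ∃ γ c : ℕ, 1 ≤ γ ∧ ∀ i j, i ≤ j →
      ((j - i : ℕ) : ℕ∞) ≤ γ * dist D (R.vert i) (R.vert j) + c
  | .inr R => ∃ γ c : ℕ, 1 ≤ γ ∧ ∀ i j, i ≤ j →
      ((j - i : ℕ) : ℕ∞) ≤ γ * dist D (R.vert j) (R.vert i) + c

/-! ### Ends (in the sense of Zuther) -/

/-- `R₁ ≼ R₂`: there are infinitely many pairwise disjoint directed `R₁`-`R₂` paths. -/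
def EndLE {D : Digraph V} (R₁ R₂ : RayOrAntiRay D) : Prop :=
  ∃ P : ℕ → DiPath D, (∀ n, (P n).first ∈ R₁.support ∧ (P n).last ∈ R₂.support) ∧
    ∀ m n, m ≠ n → Disjoint (P m).support (P n).support

/-- `R₁ ∼ R₂`: `R₁ ≼ R₂` and `R₂ ≼ R₁`. -/
def EndEquiv {D : Digraph V} (R₁ R₂ : RayOrAntiRay D) : Prop := EndLE R₁ R₂ ∧ EndLE R₂ R₁

/-- The set of ends: the equivalence classes of `∼` on all rays and anti-rays. -/
def ends (D : Digraph V) : Set (Set (RayOrAntiRay D)) :=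
  {ω | ∃ R, ω = {Q | EndEquiv R Q}}

/-- There is exactly one end. -/
def IsOneEnded (D : Digraph V) : Prop := (ends D).encard = 1

/-! ### The quasi-geodesic boundary -/

/-- `R₁ ≤ R₂`: for some `M` there are, outside of `B⁺_r(x) ∪ B⁻_r(x)` for all `r` and `x`,
directed `R₁`-`R₂` paths of length at most `M`. -/
def BoundaryLE {D : Digraph V} (R₁ R₂ : RayOrAntiRay D) : Prop :=
  ∃ M : ℕ, ∀ (r : ℕ) (x : V), ∃ P : DiPath D,
    P.first ∈ R₁.support ∧ P.last ∈ R₂.support ∧ P.length ≤ M ∧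
    Disjoint P.support (outBall D x r ∪ inBall D x r)

/-- `R₁ ≈ R₂`: `R₁ ≤ R₂` and `R₂ ≤ R₁`. -/
def BoundaryEquiv {D : Digraph V} (R₁ R₂ : RayOrAntiRay D) : Prop :=
  BoundaryLE R₁ R₂ ∧ BoundaryLE R₂ R₁

/-- The quasi-geodesic rays and anti-rays. -/
abbrev QuasiGeodesicRay (D : Digraph V) := {R : RayOrAntiRay D // R.IsQuasiGeodesic}

/-- The quasi-geodesic boundary: the set of equivalence classes of `≈` on the quasi-geodesic rays
and anti-rays. -/
def boundary (D : Digraph V) : Set (Set (QuasiGeodesicRay D)) :=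
  {η | ∃ R : QuasiGeodesicRay D, η = {Q | BoundaryEquiv R.1 Q.1}}

/-! ### Semigroups -/

/-- The right Cayley digraph of a semigroup with respect to `A`: edges from `x` to `x * a` for all
`x` and all `a ∈ A`. -/
def cayley {S : Type*} [Semigroup S] (A : Set S) : Digraph S where
  Adj x y := ∃ a ∈ A, y = x * a

/-- `A` is a finite generating set of the semigroup `S`. -/
def IsFiniteGeneratingSet {S : Type*} [Semigroup S] (A : Set S) : Prop :=
  A.Finite ∧ Subsemigroup.closure A = ⊤

/-- A finitely generated semigroup is hyperbolic if its Cayley digraph with respect to some finite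
generating set is hyperbolic. -/
def IsHyperbolicSemigroup (S : Type*) [Semigroup S] : Prop :=
  ∃ A : Set S, IsFiniteGeneratingSet A ∧ IsHyperbolic (cayley A)

end DigraphBoundary

/-! Suppose the boundary is finite; it is shown that any two quasi-geodesic rays or anti-rays are
equivalent. Fix a base vertex `o` and choose a geodesic from `o` to every vertex reachable from it.
By local finiteness, the geodesics to vertices escaping to infinity converge, along a free
ultrafilter, to geodesic rays from `o`. By finiteness of the boundary, finitely many representatives
cover all these rays up to `Close`, so each vertex can be coloured by the representative that its
chosen geodesic follows longest. One-endedness supplies infinitely many disjoint paths from one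
given ray to another. Along almost all of them consecutive vertices have close colours: otherwise a
bad edge on each path would give two sequences of adjacent vertices whose limits are not close,
against thinness of triangles (`Hyp.close_of_adjacent`). Closeness is transitive without loss of
constants, so the limit of the last vertices is close to the limit of the first ones
(`Hyp.exists_close_limits`). Stability of quasi-geodesics then turns this into paths of bounded
length far out (`IsHyp.ble_of_pathFamily`). The asymmetry of the distance is controlled by
`ForkBound`: finite distances between vertices of a ball are linearly bounded in its radius. It
yields short paths in both directions between the sides of consistently directed triangles
(`IsHyp.thin` and its reversal), hence stability of quasi-geodesics. For semigroups, stability also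
transfers thinness from one finite generating set to another (`IsHyp.transfer`), and right
cancellation bounds the in-degrees. -/

namespace DigraphBoundary

/-! ### Directed distances, geodesics and thin triangles. -/

/-- An asymmetric integer valued distance, possibly infinite, given by the relations
`W k x y`: "the distance from `x` to `y` is at most `k`". -/
structure StepMetric (V : Type*) where
  W : ℕ → V → V → Prop
  refl : ∀ x, W 0 x x
  eq_of_zero : ∀ {x y}, W 0 x y → x = y
  split : ∀ {m n x y}, W (m + n) x y → ∃ z, W m x z ∧ W n z y
  trans : ∀ {m n x y z}, W m x y → W n y z → W (m + n) x z
  mono : ∀ {m n x y}, W m x y → m ≤ n → W n x y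

namespace StepMetric

variable {V : Type*} {X : StepMetric V}

/-- The distance with all directions reversed. -/
def rev (X : StepMetric V) : StepMetric V where
  W k x y := X.W k y x
  refl := X.refl
  eq_of_zero h := (X.eq_of_zero h).symm
  split {m n x y} h := by
    rw [Nat.add_comm] at h
    obtain ⟨z, h1, h2⟩ := X.split h
    exact ⟨z, h2, h1⟩
  trans {m n x y z} h1 h2 := by
    rw [Nat.add_comm]
    exact X.trans h2 h1
  mono h := X.mono h

/-- The distance from `x` to `y` is finite. -/
def Conn (X : StepMetric V) (x y : V) : Prop := ∃ k, X.W k x y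

theorem Conn.trans {x y z : V} (h1 : X.Conn x y) (h2 : X.Conn y z) : X.Conn x z :=
  let ⟨_, h1⟩ := h1
  let ⟨_, h2⟩ := h2
  ⟨_, X.trans h1 h2⟩

/-- `g 0, …, g n` is a geodesic. -/
structure Geo (X : StepMetric V) (g : ℕ → V) (n : ℕ) : Prop where
  le : ∀ {i j}, i ≤ j → j ≤ n → X.W (j - i) (g i) (g j)
  ge : ∀ {i j k}, i ≤ j → j ≤ n → X.W k (g i) (g j) → j - i ≤ k

theorem Geo.sub {g : ℕ → V} {n a b : ℕ} (h : X.Geo g n) (hab : a ≤ b) (hb : b ≤ n) :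
    X.Geo (fun i => g (a + i)) (b - a) where
  le {i j} hij hj := by
    have := h.le (i := a + i) (j := a + j) (by omega) (by omega)
    rwa [Nat.add_sub_add_left] at this
  ge {i j k} hij hj hk := by
    have := h.ge (i := a + i) (j := a + j) (by omega) (by omega) hk
    omega

theorem Geo.init {g : ℕ → V} {n b : ℕ} (h : X.Geo g n) (hb : b ≤ n) : X.Geo g b where
  le hij hj := h.le hij (hj.trans hb)
  ge hij hj hk := h.ge hij (hj.trans hb) hk

theorem Geo.reverse {g : ℕ → V} {n : ℕ} (h : X.Geo g n) : X.rev.Geo (fun i => g (n - i)) n where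
  le {i j} hij hj := by
    have := h.le (i := n - j) (j := n - i) (by omega) (by omega)
    rwa [show n - i - (n - j) = j - i by omega] at this
  ge {i j k} hij hj hk := by
    have := h.ge (i := n - j) (j := n - i) (by omega) (by omega) hk
    omega

theorem Geo.conn {g : ℕ → V} {n i j : ℕ} (h : X.Geo g n) (hij : i ≤ j) (hj : j ≤ n) :
    X.Conn (g i) (g j) := ⟨_, h.le hij hj⟩

theorem Geo.inj {g : ℕ → V} {n i j : ℕ} (h : X.Geo g n) (hi : i ≤ n) (hj : j ≤ n)
    (hij : g i = g j) : i = j := by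
  rcases le_total i j with hl | hl
  · have := h.ge (k := 0) hl hj (hij ▸ X.refl _)
    omega
  · have := h.ge (k := 0) hl hi (hij ▸ X.refl _)
    omega

theorem chain {g : ℕ → V} {lam : ℕ} {i j : ℕ} (hij : i ≤ j)
    (h : ∀ t, i ≤ t → t < j → X.W lam (g t) (g (t + 1))) : X.W (lam * (j - i)) (g i) (g j) := by
  induction j, hij using Nat.le_induction with
  | base => simpa using X.refl _
  | succ j hij ih =>
    have := X.trans (ih fun t h1 h2 => h t h1 (by omega)) (h j hij (by omega))
    convert this using 1
    rw [show j + 1 - i = (j - i) + 1 by omega]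
    ring

theorem exists_path {n : ℕ} {x y : V} (h : X.W n x y) :
    ∃ g : ℕ → V, g 0 = x ∧ g n = y ∧ ∀ i < n, X.W 1 (g i) (g (i + 1)) := by
  induction n generalizing y with
  | zero => exact ⟨fun _ => x, rfl, X.eq_of_zero h, by simp⟩
  | succ n ih =>
    obtain ⟨z, h1, h2⟩ := X.split h
    obtain ⟨g, h0, hn, hg⟩ := ih h1
    refine ⟨fun i => if i ≤ n then g i else y, by simpa using h0, by simp, fun i hi => ?_⟩
    rcases Nat.lt_or_ge i n with hin | hin
    · simpa [hin.le, Nat.succ_le_of_lt hin] using hg i hin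
    · obtain rfl : i = n := by omega
      simpa [hn] using h2

theorem exists_geo {x y : V} (h : X.Conn x y) :
    ∃ g n, X.Geo g n ∧ g 0 = x ∧ g n = y := by
  classical
  have hf := Nat.find_spec h
  obtain ⟨g, h0, hn, hg⟩ := exists_path hf
  refine ⟨g, Nat.find h, ⟨fun {i j} hij hj => ?_, fun {i j k} hij hj hk => ?_⟩, h0, hn⟩
  · simpa using chain (X := X) (lam := 1) hij fun t _ ht => hg t (by omega)
  · have h1 := chain (X := X) (lam := 1) (Nat.zero_le i) fun t _ ht => hg t (by omega)
    have h2 := chain (X := X) (lam := 1) hj fun t _ ht => hg t (by omega)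
    rw [hn] at h2
    rw [h0] at h1
    have := Nat.find_min' h (X.trans (X.trans h1 hk) h2)
    omega

theorem Geo.length_le {g : ℕ → V} {n k : ℕ} {x y : V} (h : X.Geo g n) (h0 : g 0 = x)
    (hn : g n = y) (hk : X.W k x y) : n ≤ k := by
  subst h0 hn
  simpa using h.ge (Nat.zero_le n) le_rfl hk

/-- `g` is a geodesic between `a` and `c`, in one of the two directions. -/
def GeoBetween (X : StepMetric V) (g : ℕ → V) (n : ℕ) (a c : V) : Prop :=
  X.Geo g n ∧ ((g 0 = a ∧ g n = c) ∨ (g 0 = c ∧ g n = a))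

theorem GeoBetween.reverse {g : ℕ → V} {n : ℕ} {a c : V} (h : X.GeoBetween g n a c) :
    X.rev.GeoBetween (fun i => g (n - i)) n a c :=
  ⟨h.1.reverse, by rcases h.2 with h | h <;> simp [h]⟩

/-- Geodesic triangles are `δ`-thin. -/
def Hyp (X : StepMetric V) (δ : ℕ) : Prop :=
  ∀ (p q r : ℕ → V) (n m l : ℕ) (c : V), X.Geo p n → X.GeoBetween q m (p 0) c →
    X.GeoBetween r l (p n) c → ∀ i ≤ n,
      (∃ j ≤ m, X.W δ (q j) (p i)) ∨ (∃ j ≤ l, X.W δ (p i) (r j))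

/-- Reversal exchanges the two ends of a side and also out-balls with in-balls, so thinness is
self-dual. Later statements therefore need a proof in one direction only. -/
theorem Hyp.reverse {δ : ℕ} (h : X.Hyp δ) : X.rev.Hyp δ := by
  intro p q r n m l c hp hq hr i hi
  have := h (fun i => p (n - i)) (fun i => r (l - i)) (fun i => q (m - i)) n l m c hp.reverse
    hr.reverse
    (by rw [Nat.sub_self]; exact hq.reverse) (n - i) (by omega)
  simp only [Nat.sub_sub_self hi] at this
  rcases this with ⟨j, hj, h⟩ | ⟨j, hj, h⟩
  · exact Or.inr ⟨l - j, by omega, h⟩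
  · exact Or.inl ⟨m - j, by omega, h⟩

/-- Distances between the end points of a fork are linearly bounded if finite. -/
def ForkBound (X : StepMetric V) (C : ℕ) : Prop :=
  ∀ {x y z r s}, X.W r x y → X.W s x z → X.Conn y z → X.W (C * (r + s + 1)) y z

/-- Thin triangles together with linear bounds for forks. -/
structure IsHyp (X : StepMetric V) (δ C : ℕ) : Prop where
  hyp : X.Hyp δ
  fork : X.ForkBound C
  cofork : X.rev.ForkBound C

theorem IsHyp.reverse {δ C : ℕ} (h : X.IsHyp δ C) : X.rev.IsHyp δ C :=
  ⟨h.hyp.reverse, h.cofork, h.fork⟩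

theorem IsHyp.join {δ C : ℕ} (h : X.IsHyp δ C) {x y z : V} {r s : ℕ} (h1 : X.W r y x)
    (h2 : X.W s z x) (h3 : X.Conn y z) : X.W (C * (r + s + 1)) y z := by
  have := h.cofork (x := x) (y := z) (z := y) h2 h1 h3
  rwa [show s + r + 1 = r + s + 1 by ring] at this

/-- Every ball of radius `δ` meets every geodesic in at most `F` vertices. -/
def FiberBound (X : StepMetric V) (δ F : ℕ) : Prop :=
  ∀ (g : ℕ → V) (n : ℕ) (x : V) (s : Finset ℕ), X.Geo g n →
    (∀ i ∈ s, i ≤ n ∧ X.W δ x (g i)) → s.card ≤ F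

/-- A geodesic from `y` to `z` is covered by the `δ`-balls around the at most `r + s + 2` vertices
of the other two sides, and each ball contains at most `F` of its vertices. -/
theorem Hyp.forkBound {δ F : ℕ} (h : X.Hyp δ) (h1 : X.FiberBound δ F)
    (h2 : X.rev.FiberBound δ F) : X.ForkBound (2 * F) := by
  classical
  intro x y z r s hr hs hc
  obtain ⟨p, n, hp, p0, pn⟩ := exists_geo hc
  obtain ⟨q, m, hq, q0, qm⟩ := exists_geo ⟨r, hr⟩
  obtain ⟨u, l, hu, u0, ul⟩ := exists_geo ⟨s, hs⟩
  have hm := hq.length_le q0 qm hr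
  have hl := hu.length_le u0 ul hs
  have key := h p q u n m l x hp ⟨hq, Or.inr ⟨q0, by rw [qm, p0]⟩⟩ ⟨hu, Or.inr ⟨u0, by rw [ul, pn]⟩⟩
  have cover : Finset.range (n + 1) ⊆
      ((Finset.range (m + 1)).biUnion fun j => (Finset.range (n + 1)).filter fun i =>
        X.W δ (q j) (p i)) ∪
      ((Finset.range (l + 1)).biUnion fun j => (Finset.range (n + 1)).filter fun i =>
        X.W δ (p i) (u j)) := by
    intro i hi
    have hi' : i ≤ n := by simpa [Nat.lt_succ_iff] using hi
    simp only [Finset.mem_union, Finset.mem_biUnion, Finset.mem_filter, hi, true_and,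
      Finset.mem_range, Nat.lt_succ_iff]
    exact key i hi'
  have b1 : ∀ j, ((Finset.range (n + 1)).filter fun i => X.W δ (q j) (p i)).card ≤ F := fun j =>
    h1 p n (q j) _ hp fun i hi => by
      simp only [Finset.mem_filter, Finset.mem_range, Nat.lt_succ_iff] at hi
      exact hi
  have b2 : ∀ j, ((Finset.range (n + 1)).filter fun i => X.W δ (p i) (u j)).card ≤ F := fun j => by
    rw [← Finset.card_image_of_injOn (f := fun i => n - i)]
    · refine h2 _ n (u j) _ hp.reverse fun i hi => ?_
      simp only [Finset.mem_image, Finset.mem_filter, Finset.mem_range, Nat.lt_succ_iff] at hi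
      obtain ⟨k, ⟨hk, hw⟩, rfl⟩ := hi
      refine ⟨by omega, ?_⟩
      show X.W δ (p (n - (n - k))) (u j)
      rwa [Nat.sub_sub_self hk]
    · intro a ha b hb hab
      simp only [Finset.coe_filter, Finset.mem_range, Set.mem_ofPred_eq] at ha hb
      simp only at hab
      omega
  have := (Finset.card_le_card cover).trans (Finset.card_union_le _ _)
  have c1 := Finset.card_biUnion_le_card_mul (Finset.range (m + 1)) _ F fun j _ => b1 j
  have c2 := Finset.card_biUnion_le_card_mul (Finset.range (l + 1)) _ F fun j _ => b2 j
  simp only [Finset.card_range] at this c1 c2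
  have hn : n ≤ 2 * F * (r + s + 1) := by nlinarith
  have hw := hp.le (Nat.zero_le n) le_rfl
  rw [p0, pn] at hw
  exact X.mono hw (by omega)

theorem Hyp.isHyp {δ F : ℕ} (h : X.Hyp δ) (h1 : X.FiberBound δ F) (h2 : X.rev.FiberBound δ F) :
    X.IsHyp δ (2 * F) :=
  ⟨h, h.forkBound h1 h2, h.reverse.forkBound h2 h1⟩

/-- A geodesic between `a` and `c` contains geodesics between `a` and each of its vertices. -/
theorem GeoBetween.to_mem {q : ℕ → V} {m j : ℕ} {a c : V} (h : X.GeoBetween q m a c) (hj : j ≤ m) :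
    ∃ q' m', X.GeoBetween q' m' a (q j) ∧ ∀ t ≤ m', ∃ t' ≤ m, q' t = q t' := by
  obtain ⟨hg, ⟨h0, hm⟩ | ⟨h0, hm⟩⟩ := h
  · exact ⟨q, j, ⟨hg.init hj, Or.inl ⟨h0, rfl⟩⟩, fun t ht => ⟨t, ht.trans hj, rfl⟩⟩
  · refine ⟨_, _, ⟨hg.sub hj le_rfl, Or.inr ⟨rfl, ?_⟩⟩, fun t ht => ⟨j + t, by omega, rfl⟩⟩
    simpa [Nat.add_sub_cancel' hj] using hm

/-- The side of a thin triangle splits into a part close to the side at its start vertex and a part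
close to the side at its end vertex. -/
theorem Hyp.switch {δ : ℕ} (h : X.Hyp δ) {p q r : ℕ → V} {n m l : ℕ} {c : V} (hp : X.Geo p n)
    (hq : X.GeoBetween q m (p 0) c) (hr : X.GeoBetween r l (p n) c) :
    ∃ k ≤ n, (∀ i < k, ∃ j ≤ m, X.W δ (q j) (p i)) ∧
      ∀ i, k ≤ i → i ≤ n → ∃ j ≤ l, X.W (3 * δ + 1) (p i) (r j) := by
  classical
  have hB : ∀ i, i ≤ n → ¬ (∃ j ≤ m, X.W δ (q j) (p i)) → ∃ j ≤ l, X.W δ (p i) (r j) := fun i hi hn =>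
    (h p q r n m l c hp hq hr i hi).resolve_left hn
  have hA0 : ∃ j ≤ m, X.W δ (q j) (p 0) := by
    rcases hq.2 with ⟨e, _⟩ | ⟨_, e⟩
    · exact ⟨0, Nat.zero_le _, e ▸ X.mono (X.refl _) (Nat.zero_le _)⟩
    · exact ⟨m, le_rfl, e ▸ X.mono (X.refl _) (Nat.zero_le _)⟩
  set k := Nat.findGreatest (fun i => ∃ j ≤ m, X.W δ (q j) (p i)) n with hk
  have hkn : k ≤ n := Nat.findGreatest_le n
  obtain ⟨j, hj, hw⟩ : ∃ j ≤ m, X.W δ (q j) (p k) :=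
    Nat.findGreatest_spec (P := fun i => ∃ j ≤ m, X.W δ (q j) (p i)) (Nat.zero_le n) hA0
  have hgt : ∀ i, k < i → i ≤ n → ∃ j ≤ l, X.W δ (p i) (r j) := fun i h1 h2 =>
    hB i h2 (Nat.findGreatest_is_greatest h1 h2)
  have hkr : ∃ t ≤ l, X.W (δ + 1) (p k) (r t) := by
    rcases hkn.eq_or_lt with e | e
    · rcases hr.2 with ⟨e', _⟩ | ⟨_, e'⟩
      · exact ⟨0, Nat.zero_le _, by rw [e, e']; exact X.mono (X.refl _) (Nat.zero_le _)⟩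
      · exact ⟨l, le_rfl, by rw [e, e']; exact X.mono (X.refl _) (Nat.zero_le _)⟩
    · obtain ⟨t, ht, hw⟩ := hgt (k + 1) (by omega) e
      have := X.trans (hp.le (Nat.le_succ k) e) hw
      exact ⟨t, ht, X.mono this (by omega)⟩
  obtain ⟨t, ht, hkt⟩ := hkr
  obtain ⟨u, v, hu, u0, uv⟩ := exists_geo ⟨_, hw⟩
  have hv := hu.length_le u0 uv hw
  -- Here `p k` is the last vertex close to `q`. In the triangle on `p 0`, `p k`, `q j` the side
  -- from `q j` to `p k` has length at most `δ`, so a vertex of `p` within `δ` of it is within `2 *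
  -- δ` of `p k`. Earlier vertices must be close to `q`.
  refine ⟨k - 2 * δ, by omega, fun i hi => ?_, fun i hi hin => ?_⟩
  · obtain ⟨q', m', hq', hsub⟩ := hq.to_mem hj
    rcases h p q' u k m' v _ (hp.init hkn) hq' ⟨hu, Or.inr ⟨u0, uv⟩⟩ i (by omega) with
      ⟨t, ht, hw⟩ | ⟨t, ht, hw⟩
    · obtain ⟨t', ht', e⟩ := hsub t ht
      exact ⟨t', ht', e ▸ hw⟩
    · have h1 := X.trans hw (hu.le ht le_rfl)
      rw [uv] at h1
      have := hp.ge (by omega) hkn h1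
      omega
  · rcases Nat.lt_or_ge k i with hki | hki
    · obtain ⟨j, hj, hw⟩ := hgt i hki hin
      exact ⟨j, hj, X.mono hw (by omega)⟩
    · exact ⟨t, ht, X.mono (X.trans (hp.le hki hkn) hkt) (by omega)⟩

/-- The constant for thin triangles all of whose sides are directed consistently. -/
def thinConst (δ C : ℕ) : ℕ := 9 * δ + C * (2 * δ + 1) + 4

/-- In a triangle with sides from `a` to `b`, from `a` to `c` and from `c` to `b`, the first side
has short paths to the other two. -/
theorem IsHyp.thin {δ C : ℕ} (h : X.IsHyp δ C) {p q r : ℕ → V} {n m l : ℕ} (hp : X.Geo p n)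
    (hq : X.Geo q m) (hr : X.Geo r l) (hpq : q 0 = p 0) (hqr : q m = r 0) (hpr : r l = p n)
    {i : ℕ} (hi : i ≤ n) :
    (∃ j ≤ m, X.W (thinConst δ C) (p i) (q j)) ∨ ∃ j ≤ l, X.W (thinConst δ C) (p i) (r j) := by
  unfold thinConst
  obtain ⟨k, hkn, hA, hB⟩ := h.hyp.switch (c := r 0) hp ⟨hq, Or.inl ⟨hpq, hqr⟩⟩ ⟨hr, Or.inr ⟨rfl, hpr⟩⟩
  -- Near or after the switch, walking along `p` reaches the part close to `r`. Well before it, `p`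
  -- is only known to be close from `q`; a path back is found by applying thinness to `q` as the
  -- main side, at its vertex `q (i + δ)`.
  rcases Nat.lt_or_ge (i + (4 * δ + 2)) k with hik | hik
  · left
    obtain ⟨j, hj, hw⟩ := hA (k - 1) (by omega)
    have hjk : k - 1 ≤ j + δ := by
      have h1 := X.trans (hq.le (Nat.zero_le j) hj) hw
      rw [hpq] at h1
      have := hp.ge (Nat.zero_le _) (by omega) h1
      omega
    have hti : i + δ ≤ j := by omega
    obtain ⟨u, v, hu, u0, uv⟩ := exists_geo ⟨_, hw⟩
    have hv := hu.length_le u0 uv hw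
    have hbt : X.GeoBetween p (k - 1) (q 0) (p (k - 1)) := ⟨hp.init (by omega), Or.inl ⟨hpq.symm, rfl⟩⟩
    rcases h.hyp q p u j (k - 1) v _ (hq.init hj) hbt ⟨hu, Or.inl ⟨u0, uv⟩⟩ (i + δ) hti with
      ⟨s, hs, hw2⟩ | ⟨s, hs, hw2⟩
    · have his : i ≤ s := by
        have h1 := X.trans (hp.le (Nat.zero_le s) (by omega)) hw2
        rw [← hpq] at h1
        have := hq.ge (Nat.zero_le _) (by omega) h1
        omega
      obtain ⟨t, ht, hw3⟩ := hA s (by omega)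
      have hst : s ≤ t + δ := by
        have h1 := X.trans (hq.le (Nat.zero_le t) ht) hw3
        rw [hpq] at h1
        have := hp.ge (Nat.zero_le _) (by omega) h1
        omega
      have hsi : s - i ≤ 2 * δ + C * (2 * δ + 1) := by
        rcases Nat.lt_or_ge t (i + δ) with hlt | hge
        · omega
        · have h2 := h.fork (X.trans hw3 hw2) (X.refl _) (hq.conn hge ht)
          have := hq.ge hge ht h2
          have e : δ + δ + 0 + 1 = 2 * δ + 1 := by ring
          rw [e] at this
          omega
      exact ⟨i + δ, by omega, X.mono (X.trans (hp.le his (by omega)) hw2) (by omega)⟩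
    · exfalso
      have h1 := X.trans hw2 (hu.le hs le_rfl)
      rw [uv] at h1
      have h2 := X.trans (hq.le (Nat.zero_le (i + δ)) (by omega)) h1
      rw [hpq] at h2
      have := hp.ge (Nat.zero_le _) (by omega) h2
      omega
  · right
    rcases Nat.lt_or_ge i k with hlt | hge
    · obtain ⟨j, hj, hw⟩ := hB k le_rfl hkn
      exact ⟨j, hj, X.mono (X.trans (hp.le hlt.le hkn) hw) (by omega)⟩
    · obtain ⟨j, hj, hw⟩ := hB i hge hi
      exact ⟨j, hj, X.mono hw (by omega)⟩

/-! ### Stability of quasi-geodesics. -/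

/-- A geodesic has logarithmically short paths to every path with the same end vertices. -/
theorem IsHyp.log_near {δ C lam N : ℕ} (h : X.IsHyp δ C) {Q : ℕ → V}
    (hQ : ∀ i < N, X.W lam (Q i) (Q (i + 1))) (e : ℕ) {i j : ℕ} (hij : i ≤ j) (hjN : j ≤ N)
    (he : j - i ≤ 2 ^ e) {p : ℕ → V} {n : ℕ} (hp : X.Geo p n) (h0 : p 0 = Q i) (hn : p n = Q j)
    {t : ℕ} (ht : t ≤ n) : ∃ k ≤ N, X.W (thinConst δ C * e + lam) (p t) (Q k) := by
  induction e generalizing i j p n t with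
  | zero =>
    refine ⟨j, hjN, ?_⟩
    have hw : X.W lam (Q i) (Q j) := by
      rcases hij.eq_or_lt with e | e
      · exact e ▸ X.mono (X.refl _) (Nat.zero_le _)
      · obtain rfl : j = i + 1 := by simp at he; omega
        exact hQ i (by omega)
    have := hp.length_le h0 hn hw
    exact hn ▸ X.mono (hp.le ht le_rfl) (by omega)
  | succ e ih =>
    have hw : ∀ {a b}, a ≤ b → b ≤ N → X.Conn (Q a) (Q b) := fun {a b} hab hb =>
      ⟨_, chain hab fun t _ h2 => hQ t (by omega)⟩
    -- Each halving of the index interval costs one thin triangle.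
    obtain ⟨c, hic, hcj, h1, h2⟩ : ∃ c, i ≤ c ∧ c ≤ j ∧ c - i ≤ 2 ^ e ∧ j - c ≤ 2 ^ e := by
      rw [pow_succ] at he
      exact ⟨i + (j - i) / 2, by omega, by omega, by omega, by omega⟩
    obtain ⟨q, m, hq, q0, qm⟩ := exists_geo (hw hic (hcj.trans hjN))
    obtain ⟨r, l, hr, r0, rl⟩ := exists_geo (hw hcj hjN)
    have ex : thinConst δ C * (e + 1) + lam = thinConst δ C + (thinConst δ C * e + lam) := by ring
    rw [ex]
    rcases h.thin hp hq hr (q0.trans h0.symm) (qm.trans r0.symm) (rl.trans hn.symm) ht with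
      ⟨s, hs, hw⟩ | ⟨s, hs, hw⟩
    · obtain ⟨k, hk, hw'⟩ := ih hic (hcj.trans hjN) h1 hq q0 qm hs
      exact ⟨k, hk, X.trans hw hw'⟩
    · obtain ⟨k, hk, hw'⟩ := ih hcj hjN h2 hr r0 rl hs
      exact ⟨k, hk, X.trans hw hw'⟩

/-- `Q 0, …, Q N` is a quasi-geodesic: steps have length at most `lam` and index differences are
bounded by `γ d + c`. -/
structure Quasi (X : StepMetric V) (Q : ℕ → V) (N lam γ c : ℕ) : Prop where
  step : ∀ {i}, i < N → X.W lam (Q i) (Q (i + 1))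
  ge : ∀ {i j k}, i ≤ j → j ≤ N → X.W k (Q i) (Q j) → j - i ≤ γ * k + c

variable {Q : ℕ → V} {N lam γ c δ C : ℕ}

theorem Quasi.le (h : X.Quasi Q N lam γ c) {i j : ℕ} (hij : i ≤ j) (hj : j ≤ N) :
    X.W (lam * (j - i)) (Q i) (Q j) := chain hij fun _ _ h2 => h.step (by omega)

theorem Quasi.conn (h : X.Quasi Q N lam γ c) {i j : ℕ} (hij : i ≤ j) (hj : j ≤ N) :
    X.Conn (Q i) (Q j) := ⟨_, h.le hij hj⟩

theorem Quasi.reverse (h : X.Quasi Q N lam γ c) : X.rev.Quasi (fun i => Q (N - i)) N lam γ c where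
  step {i} hi := by
    have := h.step (i := N - (i + 1)) (by omega)
    rwa [show N - (i + 1) + 1 = N - i by omega] at this
  ge {i j k} hij hj hk := by
    have := h.ge (i := N - j) (j := N - i) (by omega) (by omega) hk
    omega

theorem sq_le_two_pow_succ (x : ℕ) : x * x ≤ 2 ^ (x + 1) := by
  rcases Nat.lt_or_ge x 3 with h | h
  · interval_cases x <;> norm_num
  · induction x, h using Nat.le_induction with
    | base => norm_num
    | succ n hn ih =>
      rw [pow_succ]
      nlinarith

/-- With `x` the logarithm, `x * x ≤ 2 ^ (x + 1)` is at most four times `B * (A + K * x) + E`, a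
linear function of `x`; this bounds `x` and hence `D`. It ends the bootstrap in
`IsHyp.exists_stability`. -/
theorem bounded_of_le_clog (A K B E : ℕ) :
    ∃ D₀, ∀ D, D ≤ A + K * Nat.clog 2 (B * D + E) → D ≤ D₀ := by
  refine ⟨A + K * (4 * B * A + 4 * B * K + 4 * E + 2), fun D hD => hD.trans ?_⟩
  set x := Nat.clog 2 (B * D + E) with hx
  gcongr
  rcases Nat.eq_zero_or_pos x with h0 | hpos
  · omega
  have hlt : 2 ^ (x - 1) ≤ B * D + E := by
    by_contra hcon
    push Not at hcon
    have := Nat.clog_le_of_le_pow hcon.le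
    omega
  have h2 : 2 ^ (x + 1) = 4 * 2 ^ (x - 1) := by
    obtain ⟨y, hy⟩ : ∃ y, x = y + 1 := ⟨x - 1, by omega⟩
    rw [hy]
    simp only [Nat.add_sub_cancel]
    ring
  have h3 := sq_le_two_pow_succ x
  have h4 : B * D ≤ B * (A + K * x) := Nat.mul_le_mul_left _ hD
  have h5 : x * x ≤ 4 * (B * (A + K * x) + E) := by omega
  by_contra hcon
  push Not at hcon
  have h6 : (4 * B * A + 4 * B * K + 4 * E + 2) * x ≤ x * x := Nat.mul_le_mul_right _ hcon.le
  have h7 : 4 * B * A ≤ 4 * B * A * x := Nat.le_mul_of_pos_right _ hpos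
  have h8 : 4 * E ≤ 4 * E * x := Nat.le_mul_of_pos_right _ hpos
  nlinarith

/-- Positions of consecutive vertices of a geodesic on a nearby quasi-geodesic differ by a bounded
amount. -/
theorem IsHyp.jump (h : X.IsHyp δ C) (hQ : X.Quasi Q N lam γ c) {p : ℕ → V} {n t D a b : ℕ}
    (hp : X.Geo p n) (ht : t < n) (hb : b ≤ N) (hab : a ≤ b)
    (ha' : X.W D (p t) (Q a)) (hb' : X.W D (p (t + 1)) (Q b)) :
    b - a ≤ γ * (C * (2 * D + 2)) + c := by
  have h1 := hp.le (Nat.le_succ t) ht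
  rw [show t.succ - t = 1 by omega] at h1
  have := h.fork ha' (X.trans h1 hb') (hQ.conn hab hb)
  rw [show D + (1 + D) + 1 = 2 * D + 2 by ring] at this
  exact hQ.ge hab hb this

/-- If a function on `[0, n]` starts at a value at most `k`, then there is a last such argument. -/
theorem exists_last {s : ℕ → ℕ} {k n : ℕ} (h0 : s 0 ≤ k) :
    ∃ t ≤ n, s t ≤ k ∧ (t < n → k < s (t + 1)) := by
  refine ⟨Nat.findGreatest (fun t => s t ≤ k) n, Nat.findGreatest_le n,
    Nat.findGreatest_spec (P := fun t => s t ≤ k) (Nat.zero_le n) h0, fun hlt => ?_⟩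
  exact Nat.lt_of_not_le (Nat.findGreatest_is_greatest (P := fun t => s t ≤ k) (Nat.lt_succ_self _) hlt)

/-- A choice of positions on a sequence `Q` close to the vertices of `p`. -/
theorem exists_position {p : ℕ → V} {n D : ℕ} (h0 : p 0 = Q 0)
    (hout : ∀ t ≤ n, ∃ k ≤ N, X.W D (p t) (Q k)) :
    ∃ s : ℕ → ℕ, s 0 = 0 ∧ (∀ t ≤ n, s t ≤ N) ∧ ∀ t ≤ n, X.W D (p t) (Q (s t)) := by
  choose f hf using hout
  refine ⟨fun t => if ht : t ≤ n then (if t = 0 then 0 else f t ht) else 0, by simp, ?_, ?_⟩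
  · intro t ht
    by_cases e : t = 0
    · simp [e]
    · simp [e, ht, (hf t ht).1]
  · intro t ht
    by_cases e : t = 0
    · simp only [e, Nat.zero_le, dite_true, if_true, h0]
      exact X.mono (X.refl _) (Nat.zero_le _)
    · simp only [ht, e, dite_true, if_false]
      exact (hf t ht).2

/-- The detour length in `IsHyp.improve`. -/
def detour (C γ c D : ℕ) : ℕ :=
  γ * (C * (C * (D + 2 * ((C + 2) * D) + 1) + D + 1) + C * (2 * D + 2)) + c

/-- A bound `D` for the distance from a geodesic to and from a quasi-geodesic can be improved to one
that is logarithmic in `D`. -/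
theorem IsHyp.improve (h : X.IsHyp δ C) (hQ : X.Quasi Q N lam γ c) {p : ℕ → V} {n D : ℕ}
    (hp : X.Geo p n) (h0 : p 0 = Q 0) (hn : p n = Q N)
    (hout : ∀ t ≤ n, ∃ k ≤ N, X.W D (p t) (Q k)) (hin : ∀ t ≤ n, ∃ k ≤ N, X.W D (Q k) (p t)) :
    ∀ t ≤ n, ∃ k ≤ N, X.W (2 * thinConst δ C + lam + C * (2 * thinConst δ C + 1) +
      thinConst δ C * Nat.clog 2 (detour C γ c D)) (p t) (Q k) := by
  intro t ht
  set κ := thinConst δ C with hκ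
  set M := detour C γ c D with hM
  rcases Nat.lt_or_ge (2 * κ + lam + C * (2 * κ + 1)) D with hD | hD
  swap
  · obtain ⟨k, hk, hw⟩ := hout t ht
    exact ⟨k, hk, X.mono hw (by omega)⟩
  -- positions on the quasi-geodesic
  obtain ⟨s, hs0, hsN, hs⟩ := exists_position h0 hout
  -- A window of `K * D` on either side of `t` is so wide that `p t` cannot be close to the
  -- connecting paths of length at most `D` at its ends: the fork bound for such a path costs about
  -- `C * D`.
  set K := C + 2 with hK
  set t₁ := t - K * D with ht₁
  obtain ⟨t₂, k₂, D₂, htt₂, ht₂n, hk₂, hD₂, hw₂, ht₂K, hfar⟩ : ∃ t₂ k₂ D₂, t ≤ t₂ ∧ t₂ ≤ n ∧ k₂ ≤ N ∧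
      D₂ ≤ D ∧ X.W D₂ (Q k₂) (p t₂) ∧ t₂ ≤ t + K * D ∧ (D₂ = 0 ∨ t₂ = t + K * D) := by
    rcases Nat.lt_or_ge (t + K * D) n with hl | hl
    · obtain ⟨k, hk, hw⟩ := hin (t + K * D) hl.le
      exact ⟨t + K * D, k, D, by omega, hl.le, hk, le_rfl, hw, le_rfl, Or.inr rfl⟩
    · exact ⟨n, N, 0, ht, le_rfl, le_rfl, Nat.zero_le _, hn ▸ X.refl _, hl, Or.inl rfl⟩
  -- Since `Q` can only be followed forwards, the left end of the window is moved back until its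
  -- position is at most `k₂`. If it moves, the position jumps over `k₂` at the next vertex, and
  -- `IsHyp.jump` bounds the detour.
  obtain ⟨t₀, ht₀, hst₀, hlast⟩ := exists_last (s := s) (k := k₂) (n := t₁) (by omega)
  have hst₀N : s t₀ ≤ N := hsN _ (by omega)
  have hlen : k₂ - s t₀ ≤ M := by
    rw [hM, detour, Nat.mul_add γ, ← hK]
    rcases ht₀.eq_or_lt with e | e
    · have hc : X.Conn (Q (s t₀)) (Q k₂) := hQ.conn hst₀ hk₂
      have h1 := h.fork (hs t₀ (by omega)) (X.mono (hp.le (i := t₀) (j := t₂) (by omega) ht₂n)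
        (show t₂ - t₀ ≤ 2 * (K * D) by omega)) (hc.trans ⟨_, hw₂⟩)
      have h2 := h.join h1 (X.mono hw₂ hD₂) hc
      have h3 := hQ.ge hst₀ hk₂ h2
      omega
    · have hl := hlast e
      have h1 := h.jump hQ hp (t := t₀) (by omega) (hsN (t₀ + 1) (by omega)) (by omega)
        (hs t₀ (by omega)) (hs (t₀ + 1) (by omega))
      omega
  obtain ⟨α, nα, hα, α0, αn⟩ := exists_geo ⟨_, hs t₀ (by omega)⟩
  obtain ⟨β, nβ, hβ, β0, βn⟩ := exists_geo (hQ.conn hst₀ hk₂)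
  obtain ⟨ω, nω, hω, ω0, ωn⟩ := exists_geo ⟨_, hw₂⟩
  obtain ⟨ε, nε, hε, ε0, εn⟩ := exists_geo (X := X) (Conn.trans ⟨_, hs t₀ (by omega)⟩ (hQ.conn hst₀ hk₂))
  have hnα := hα.length_le α0 αn (hs t₀ (by omega))
  have hnω := hω.length_le ω0 ωn hw₂
  have hp' := hp.sub (a := t₀) (b := t₂) (by omega) ht₂n
  have hpt : p (t₀ + (t - t₀)) = p t := by rw [Nat.add_sub_cancel' (by omega)]
  -- The detour from `p t₀` along `α`, `β`, `ω` to `p t₂` is cut into two consistently directed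
  -- triangles by `ε`. Only closeness to `β` survives, and `β` is logarithmically close to `Q`.
  have step1 := h.thin hp' hε hω (by simpa using ε0) (εn.trans ω0.symm)
    (by simpa [Nat.add_sub_cancel' (show t₀ ≤ t₂ by omega)] using ωn) (i := t - t₀) (by omega)
  simp only [hpt] at step1
  rcases step1 with ⟨j, hj, hw⟩ | ⟨j, hj, hw⟩
  · rcases h.thin hε hα hβ (α0.trans ε0.symm) (αn.trans β0.symm) (βn.trans εn.symm) hj with
      ⟨i, hi, hw'⟩ | ⟨i, hi, hw'⟩
    · -- close to the first piece of the detour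
      have hw3 := X.trans hw hw'
      rcases Nat.eq_zero_or_pos t₀ with e | e
      · have : nα = 0 := Nat.le_zero.1 (hα.length_le α0 αn (by rw [e, hs0, h0]; exact X.refl _))
        obtain rfl : i = 0 := by omega
        rw [α0, e, h0] at hw3
        exact ⟨0, Nat.zero_le _, X.mono hw3 (by omega)⟩
      · exfalso
        have h1 := hα.le (Nat.zero_le i) hi
        rw [α0] at h1
        have h2 := h.join (X.mono h1 (show i - 0 ≤ D by omega)) hw3 (hp.conn (by omega) ht)
        have h3 := hp.ge (by omega) ht h2
        have h4 : K * D ≤ t - t₀ := by omega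
        have h5 : K * D = C * D + 2 * D := by rw [hK]; ring
        have h6 : C * (D + (κ + κ) + 1) = C * D + C * (2 * κ + 1) := by ring
        rw [← hκ] at h3
        omega
    · -- close to the quasi-geodesic
      have hlog : k₂ - s t₀ ≤ 2 ^ Nat.clog 2 M := hlen.trans (Nat.le_pow_clog (by norm_num) _)
      obtain ⟨k, hk, hw''⟩ := h.log_near (Q := Q) (fun _ hi => hQ.step hi) _ hst₀ hk₂ hlog hβ β0 βn hi
      refine ⟨k, hk, X.mono (X.trans (X.trans hw hw') hw'') ?_⟩
      rw [← hκ]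
      omega
  · -- close to the last piece of the detour
    rcases hfar with e | e
    · obtain rfl : j = 0 := by omega
      exact ⟨k₂, hk₂, ω0 ▸ X.mono hw (by omega)⟩
    · exfalso
      have h1 := X.trans hw (hω.le hj le_rfl)
      rw [ωn] at h1
      have h2 := hp.ge htt₂ ht₂n h1
      have h5 : K * D = C * D + 2 * D := by rw [hK]; ring
      rw [← hκ] at h2
      omega

/-- Geodesic stability: geodesics stay close to quasi-geodesics with the same end vertices. -/
theorem IsHyp.exists_stability (δ C lam γ c : ℕ) : ∃ κ, ∀ {V : Type*} {X : StepMetric V},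
    X.IsHyp δ C → ∀ {Q N}, X.Quasi Q N lam γ c → ∀ {p n}, X.Geo p n → p 0 = Q 0 → p n = Q N →
      ∀ t ≤ n, (∃ k ≤ N, X.W κ (p t) (Q k)) ∧ ∃ k ≤ N, X.W κ (Q k) (p t) := by
  set K := thinConst δ C
  obtain ⟨κ, hκ⟩ := bounded_of_le_clog (2 * K + lam + C * (2 * K + 1)) K
    (γ * (C * (C * (1 + 2 * (C + 2)) + 1) + 2 * C)) (γ * (C * (C + 1) + 2 * C) + c)
  refine ⟨κ, fun {V X} h {Q N} hQ {p n} hp h0 hn => ?_⟩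
  classical
  -- The least `D` working in both directions cannot exceed its own improvement, which is
  -- logarithmic in `D`; so it is bounded independently of the geodesic.
  have ex : ∃ D, ∀ t ≤ n, (∃ k ≤ N, X.W D (p t) (Q k)) ∧ ∃ k ≤ N, X.W D (Q k) (p t) := by
    refine ⟨n, fun t ht => ⟨⟨N, le_rfl, ?_⟩, 0, Nat.zero_le _, ?_⟩⟩
    · exact hn ▸ X.mono (hp.le ht le_rfl) (by omega)
    · exact h0 ▸ X.mono (hp.le (Nat.zero_le t) ht) (by omega)
  have hD := Nat.find_spec ex
  set D := Nat.find ex with hDdef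
  have i1 := h.improve hQ hp h0 hn (fun t ht => (hD t ht).1) (fun t ht => (hD t ht).2)
  have i2 := h.reverse.improve hQ.reverse hp.reverse (by simpa using hn) (by simpa using h0) (D := D)
    (fun t ht => by
      obtain ⟨k, hk, hw⟩ := (hD (n - t) (by omega)).2
      exact ⟨N - k, by omega, by simpa [rev, Nat.sub_sub_self hk] using hw⟩)
    (fun t ht => by
      obtain ⟨k, hk, hw⟩ := (hD (n - t) (by omega)).1
      exact ⟨N - k, by omega, by simpa [rev, Nat.sub_sub_self hk] using hw⟩)
  have hle : D ≤ 2 * K + lam + C * (2 * K + 1) + K * Nat.clog 2 (detour C γ c D) := by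
    refine Nat.find_min' ex fun t ht => ⟨i1 t ht, ?_⟩
    obtain ⟨k, hk, hw⟩ := i2 (n - t) (by omega)
    exact ⟨N - k, by omega, by simpa [rev, Nat.sub_sub_self ht] using hw⟩
  have hdet : detour C γ c D = γ * (C * (C * (1 + 2 * (C + 2)) + 1) + 2 * C) * D +
      (γ * (C * (C + 1) + 2 * C) + c) := by
    unfold detour
    ring
  have := hκ D (by rwa [← hdet])
  intro t ht
  obtain ⟨⟨k, hk, hw⟩, k', hk', hw'⟩ := hD t ht
  exact ⟨⟨k, hk, X.mono hw this⟩, k', hk', X.mono hw' this⟩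

/-- If a geodesic stays close to a quasi-geodesic, then the latter stays close to the former. -/
theorem IsHyp.near_geo (h : X.IsHyp δ C) (hQ : X.Quasi Q N lam γ c) {p : ℕ → V} {n κ : ℕ}
    (hp : X.Geo p n) (h0 : p 0 = Q 0) (hn : p n = Q N)
    (hκ : ∀ t ≤ n, ∃ k ≤ N, X.W κ (p t) (Q k)) {k : ℕ} (hk : k ≤ N) :
    ∃ t ≤ n, X.W (κ + lam * (γ * (C * (2 * κ + 2)) + c)) (p t) (Q k) := by
  obtain ⟨s, hs0, hsN, hs⟩ := exists_position h0 hκ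
  obtain ⟨t, ht, hst, hlast⟩ := exists_last (s := s) (k := k) (n := n) (by omega)
  have hlen : k - s t ≤ γ * (C * (2 * κ + 2)) + c := by
    rcases ht.eq_or_lt with e | e
    · have hw := hs t ht
      have hs' := hsN t ht
      rw [e, hn] at hw
      rw [e] at hst hs' ⊢
      have h2 := h.fork hw (X.refl _) (hQ.conn hs' le_rfl)
      have h3 := hQ.ge hs' le_rfl (X.mono h2 (show _ ≤ C * (2 * κ + 2) from
        Nat.mul_le_mul_left _ (by omega)))
      omega
    · have := h.jump hQ hp e (hsN (t + 1) e) (by have := hlast e; omega) (hs t ht) (hs (t + 1) e)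
      have := hlast e
      omega
  exact ⟨t, ht, X.mono (X.trans (hs t ht) (hQ.le hst hk))
    (Nat.add_le_add_left (Nat.mul_le_mul_left _ hlen) _)⟩

/-- Geodesics and quasi-geodesics with the same end vertices stay close to each other. -/
theorem IsHyp.exists_fellow (δ C lam γ c : ℕ) : ∃ κ, ∀ {V : Type*} {X : StepMetric V},
    X.IsHyp δ C → ∀ {Q N}, X.Quasi Q N lam γ c → ∀ {p n}, X.Geo p n → p 0 = Q 0 → p n = Q N →
      (∀ t ≤ n, (∃ k ≤ N, X.W κ (p t) (Q k)) ∧ ∃ k ≤ N, X.W κ (Q k) (p t)) ∧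
      ∀ k ≤ N, (∃ t ≤ n, X.W κ (p t) (Q k)) ∧ ∃ t ≤ n, X.W κ (Q k) (p t) := by
  obtain ⟨κ, hκ⟩ := IsHyp.exists_stability δ C lam γ c
  refine ⟨κ + lam * (γ * (C * (2 * κ + 2)) + c), fun {V X} h {Q N} hQ {p n} hp h0 hn => ?_⟩
  have hs := hκ h hQ hp h0 hn
  refine ⟨fun t ht => ?_, fun k hk => ⟨h.near_geo hQ hp h0 hn (fun t ht => (hs t ht).1) hk, ?_⟩⟩
  · obtain ⟨⟨k, hk, hw⟩, k', hk', hw'⟩ := hs t ht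
    exact ⟨⟨k, hk, X.mono hw (Nat.le_add_right _ _)⟩, k', hk', X.mono hw' (Nat.le_add_right _ _)⟩
  · obtain ⟨t, ht, hw⟩ := h.reverse.near_geo hQ.reverse hp.reverse (by simpa using hn)
      (by simpa using h0) (κ := κ) (fun t ht => by
        obtain ⟨k, hk, hw⟩ := (hs (n - t) (by omega)).2
        exact ⟨N - k, by omega, by simpa [rev, Nat.sub_sub_self hk] using hw⟩)
      (k := N - k) (by omega)
    exact ⟨n - t, by omega, by simpa [rev, Nat.sub_sub_self hk] using hw⟩

/-! ### Change of the distance by bounded factors. -/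

/-- Hyperbolicity is invariant under changing the distance by bounded factors. -/
theorem IsHyp.transfer {Y : StepMetric V} {δ C lam : ℕ} (h : Y.IsHyp δ C)
    (hXY : ∀ {k x y}, X.W k x y → Y.W (lam * k) x y)
    (hYX : ∀ {k x y}, Y.W k x y → X.W (lam * k) x y) : ∃ δ', X.Hyp δ' := by
  obtain ⟨κ, hκ⟩ := IsHyp.exists_fellow δ C lam lam 0
  have hconn : ∀ {x y}, X.Conn x y → Y.Conn x y := fun ⟨_, h⟩ => ⟨_, hXY h⟩
  have hquasi : ∀ {g n}, X.Geo g n → Y.Quasi g n lam lam 0 := fun {g n} hg =>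
    ⟨fun {i} hi => by
      have := hXY (hg.le (Nat.le_succ i) hi)
      rwa [show i.succ - i = 1 by omega, mul_one] at this,
    fun hij hj hk => hg.ge hij hj (hYX hk)⟩
  -- replace a side by a geodesic of the other distance
  have replace : ∀ {q m a c}, X.GeoBetween q m a c → ∃ q' m', Y.GeoBetween q' m' a c ∧
      ∀ t ≤ m', (∃ k ≤ m, Y.W κ (q' t) (q k)) ∧ ∃ k ≤ m, Y.W κ (q k) (q' t) := by
    intro q m a c hq
    obtain ⟨q', m', hq', q0, qm⟩ := exists_geo (hconn (hq.1.conn (Nat.zero_le m) le_rfl))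
    exact ⟨q', m', ⟨hq', by rw [q0, qm]; exact hq.2⟩, (@hκ V Y h _ _ (hquasi hq.1) _ _ hq' q0 qm).1⟩
  refine ⟨lam * (κ + (C * (κ + κ + 0 + 1) + (3 * δ + 1) + κ)), ?_⟩
  intro p q r n m l c hp hq hr i hi
  obtain ⟨p', n', hp', p0, pn⟩ := exists_geo (hconn (hp.conn (Nat.zero_le n) le_rfl))
  obtain ⟨q', m', hq', hqq⟩ := replace hq
  obtain ⟨r', l', hr', hrr⟩ := replace hr
  obtain ⟨⟨t, ht, hw⟩, t', ht', hw'⟩ := (@hκ V Y h _ _ (hquasi hp) _ _ hp' p0 pn).2 i hi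
  obtain ⟨k, hkn, hA, hB⟩ := h.hyp.switch hp' (p0 ▸ hq') (pn ▸ hr')
  rcases Nat.lt_or_ge t k with h1 | h1
  · left
    obtain ⟨j, hj, hj'⟩ := hA t h1
    obtain ⟨a, ha, ha'⟩ := (hqq j hj).2
    exact ⟨a, ha, X.mono (hYX (Y.trans (Y.trans ha' hj') hw)) (Nat.mul_le_mul_left _ (by omega))⟩
  · right
    have fin : ∀ s, k ≤ s → s ≤ n' → Y.W (κ + C * (κ + κ + 0 + 1)) (p i) (p' s) →
        ∃ j ≤ l, X.W (lam * (κ + (C * (κ + κ + 0 + 1) + (3 * δ + 1) + κ))) (p i) (r j) := by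
      intro s hs hsn hw
      obtain ⟨j, hj, hj'⟩ := hB s hs hsn
      obtain ⟨a, ha, ha'⟩ := (hrr j hj).1
      exact ⟨a, ha, X.mono (hYX (Y.trans (Y.trans hw hj') ha')) (Nat.mul_le_mul_left _ (by omega))⟩
    -- The vertex `p' t` before `p i` and the vertex `p' t'` after it may lie on different sides of
    -- the switch. If `t' < k ≤ t`, then `p' t` reaches `p' t'` backwards along a short path, so the
    -- fork bound gives a short path from `p' t'` on to `p' t`.
    rcases Nat.lt_or_ge t' k with h2 | h2
    · refine fin t h1 ht (Y.trans hw' ?_)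
      have := h.fork (Y.trans hw hw') (Y.refl _) (hp'.conn (by omega) ht)
      exact this
    · exact fin t' h2 ht' (Y.mono hw' (by omega))

end StepMetric
end DigraphBoundary

/-! ### Geodesic rays and closeness. -/

namespace DigraphBoundary
namespace StepMetric

open Filter

variable {V : Type*} {X : StepMetric V}

/-- Balls are finite. -/
def FinBalls (X : StepMetric V) : Prop :=
  ∀ k x, {y | X.W k x y}.Finite ∧ {y | X.W k y x}.Finite

theorem FinBalls.reverse (h : X.FinBalls) : X.rev.FinBalls := fun k x => (h k x).symm

theorem FinBalls.out (h : X.FinBalls) (k : ℕ) {F : Set V} (hF : F.Finite) :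
    {y | ∃ x ∈ F, X.W k x y}.Finite := by
  have := hF.biUnion fun x _ => (h k x).1
  refine this.subset fun y hy => ?_
  simpa using hy

theorem FinBalls.into (h : X.FinBalls) (k : ℕ) {F : Set V} (hF : F.Finite) :
    {y | ∃ x ∈ F, X.W k y x}.Finite := h.reverse.out k hF

/-- There are paths of bounded length from `A` to `B` outside of every finite set. -/
def BLE (X : StepMetric V) (A B : Set V) : Prop :=
  ∃ M, ∀ F : Set V, F.Finite → ∃ u ∈ A, ∃ w ∈ B, u ∉ F ∧ X.W M u w

/-- Starting vertices that reach `F` within `M` steps are avoided as well. -/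
theorem BLE.avoid {A B : Set V} (hf : X.FinBalls) (h : X.BLE A B) :
    ∃ M, ∀ F : Set V, F.Finite → ∃ u ∈ A, ∃ w ∈ B, u ∉ F ∧ w ∉ F ∧ X.W M u w := by
  obtain ⟨M, hM⟩ := h
  refine ⟨M, fun F hF => ?_⟩
  obtain ⟨u, hu, w, hw, hn, hW⟩ := hM _ (hF.union (hf.into M hF))
  simp only [Set.mem_union, Set.mem_ofPred_eq, not_or, not_exists, not_and] at hn
  exact ⟨u, hu, w, hw, hn.1, fun h => hn.2 w h hW, hW⟩

theorem BLE.reverse {A B : Set V} (hf : X.FinBalls) (h : X.BLE A B) : X.rev.BLE B A := by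
  obtain ⟨M, hM⟩ := h.avoid hf
  refine ⟨M, fun F hF => ?_⟩
  obtain ⟨u, hu, w, hw, _, hn, hW⟩ := hM F hF
  exact ⟨w, hw, u, hu, hn, hW⟩

theorem exists_notMem_of_injective {g : ℕ → V} (hg : Function.Injective g) {F : Set V}
    (hF : F.Finite) : ∃ t, g t ∉ F := by
  by_contra hcon
  push Not at hcon
  exact Set.infinite_range_of_injective hg (hF.subset (Set.range_subset_iff.2 hcon))

/-- The sequence `g` leaves `E` and the finite set of vertices reachable from `F` within `M` steps,
which keeps `u` outside `F`. The set `E` allows for finitely many exceptions. -/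
theorem BLE.of_injective {A B E : Set V} {g : ℕ → V} {M M' : ℕ} (hf : X.FinBalls)
    (hg : Function.Injective g) (hE : E.Finite) (hA : ∀ t, ∃ u ∈ A, X.W M u (g t))
    (hB : ∀ t, g t ∉ E → ∃ w ∈ B, X.W M' (g t) w) : X.BLE A B := by
  refine ⟨M + M', fun F hF => ?_⟩
  obtain ⟨t, ht⟩ := exists_notMem_of_injective hg (hE.union (hf.out M hF))
  simp only [Set.mem_union, Set.mem_ofPred_eq, not_or, not_exists, not_and] at ht
  obtain ⟨u, hu, h1⟩ := hA t
  obtain ⟨w, hw, h2⟩ := hB t ht.1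
  exact ⟨u, hu, w, hw, fun h => ht.2 u h h1, X.trans h1 h2⟩

/-- A geodesic ray. -/
def GeoRay (X : StepMetric V) (ρ : ℕ → V) : Prop := ∀ n, X.Geo ρ n

theorem GeoRay.injective {ρ : ℕ → V} (h : X.GeoRay ρ) : Function.Injective ρ := fun i j hij =>
  (h (max i j)).inj (le_max_left _ _) (le_max_right _ _) hij

/-- Every vertex of `ξ` is reached by a path of length at most `δ` from `ζ`. -/
def Close (X : StepMetric V) (δ : ℕ) (ξ ζ : ℕ → V) : Prop := ∀ t, ∃ s, X.W δ (ζ s) (ξ t)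

theorem Close.refl (δ : ℕ) (ξ : ℕ → V) : X.Close δ ξ ξ := fun t =>
  ⟨t, X.mono (X.refl _) (Nat.zero_le _)⟩

theorem Close.ble {δ : ℕ} {ξ ζ : ℕ → V} (hf : X.FinBalls) (hξ : X.GeoRay ξ) (h : X.Close δ ξ ζ) :
    X.BLE (Set.range ζ) (Set.range ξ) := by
  refine BLE.of_injective (M := δ) (M' := 0) hf hξ.injective Set.finite_empty (fun t => ?_)
    fun t _ => ⟨_, ⟨t, rfl⟩, X.refl _⟩
  obtain ⟨s, hs⟩ := h t
  exact ⟨_, ⟨s, rfl⟩, hs⟩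

/-- The two rays form a triangle with a short third side, chosen so far out that it cannot be
reached from `ξ t` or `ζ t` within `δ`. The constant `δ` does not depend on the `M` of `BLE`. -/
theorem Hyp.close_of_ble {δ : ℕ} (h : X.Hyp δ) (hf : X.FinBalls) {ξ ζ : ℕ → V} (hξ : X.GeoRay ξ)
    (hζ : X.GeoRay ζ) (h0 : ξ 0 = ζ 0) (hb : X.BLE (Set.range ξ) (Set.range ζ)) :
    X.Close δ ξ ζ ∧ X.Close δ ζ ξ := by
  obtain ⟨M, hM⟩ := hb.avoid hf
  have key : ∀ t, ∃ a b u l, t ≤ a ∧ t ≤ b ∧ X.GeoBetween u l (ξ a) (ζ b) ∧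
      (∀ j ≤ l, ¬ X.W δ (ξ t) (u j)) ∧ ∀ j ≤ l, ¬ X.W δ (ζ t) (u j) := by
    intro t
    obtain ⟨_, ⟨a, rfl⟩, _, ⟨b, rfl⟩, ha, hb, hW⟩ := hM
      ((ξ '' Set.Iic t ∪ ζ '' Set.Iic t) ∪ ({y | X.W (δ + M) (ξ t) y} ∪ {y | X.W (δ + M) (ζ t) y}))
      ((((Set.finite_Iic t).image _).union ((Set.finite_Iic t).image _)).union
        ((hf _ _).1.union (hf _ _).1))
    simp only [Set.mem_union, Set.mem_image, Set.mem_Iic, Set.mem_ofPred_eq, not_or, not_exists,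
      not_and] at ha hb
    obtain ⟨u, l, hu, u0, ul⟩ := exists_geo ⟨_, hW⟩
    have hl := hu.length_le u0 ul hW
    have hu' : ∀ j ≤ l, X.W M (u j) (ζ b) := fun j hj => ul ▸ X.mono (hu.le hj le_rfl) (by omega)
    refine ⟨a, b, u, l, ?_, ?_, ⟨hu, Or.inl ⟨u0, ul⟩⟩, fun j hj hw => ?_, fun j hj hw => ?_⟩
    · by_contra hlt
      exact ha.1.1 a (by omega) rfl
    · by_contra hlt
      exact hb.1.2 b (by omega) rfl
    · exact hb.2.1 (X.trans hw (hu' j hj))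
    · exact hb.2.2 (X.trans hw (hu' j hj))
  constructor <;> intro t <;> obtain ⟨a, b, u, l, ha, hb, hu, h1, h2⟩ := key t
  · rcases h ξ ζ u a b l (ζ b) (hξ a) ⟨hζ b, Or.inl ⟨h0.symm, rfl⟩⟩ hu t ha with
      ⟨j, _, hw⟩ | ⟨j, hj, hw⟩
    · exact ⟨j, hw⟩
    · exact absurd hw (h1 j hj)
  · rcases h ζ ξ u b a l (ξ a) (hζ b) ⟨hξ a, Or.inl ⟨h0, rfl⟩⟩ ⟨hu.1, hu.2.symm⟩ t hb with
      ⟨j, _, hw⟩ | ⟨j, hj, hw⟩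
    · exact ⟨j, hw⟩
    · exact absurd hw (h2 j hj)

theorem Close.symm {δ : ℕ} {ξ ζ : ℕ → V} (h : X.Hyp δ) (hf : X.FinBalls) (hξ : X.GeoRay ξ)
    (hζ : X.GeoRay ζ) (h0 : ξ 0 = ζ 0) (hc : X.Close δ ξ ζ) : X.Close δ ζ ξ :=
  (h.close_of_ble hf hζ hξ h0.symm (hc.ble hf hξ)).1

/-- Composition first gives `δ + δ`, and `Hyp.close_of_ble` restores `δ`. This permits chains of
unbounded length along a path. -/
theorem Close.trans {δ : ℕ} {ξ ζ ω : ℕ → V} (h : X.Hyp δ) (hf : X.FinBalls) (hξ : X.GeoRay ξ)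
    (hω : X.GeoRay ω) (h0 : ξ 0 = ω 0) (h1 : X.Close δ ξ ζ) (h2 : X.Close δ ζ ω) :
    X.Close δ ξ ω := by
  have hc : X.Close (δ + δ) ξ ω := fun t => by
    obtain ⟨s, hs⟩ := h1 t
    obtain ⟨r, hr⟩ := h2 s
    exact ⟨r, X.trans hr hs⟩
  exact (h.close_of_ble hf hω hξ h0.symm (hc.ble hf hξ)).2

/-! ### Limits of geodesics and a finite colouring of the vertices. -/

/-- A choice of geodesics from a fixed vertex. -/
structure Geodesics (X : StepMetric V) (o : V) where
  path : V → ℕ → V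
  len : V → ℕ
  geo : ∀ {v}, X.Conn o v → X.Geo (path v) (len v)
  zero : ∀ {v}, X.Conn o v → path v 0 = o
  last : ∀ {v}, X.Conn o v → path v (len v) = v

theorem exists_geodesics (X : StepMetric V) (o : V) : Nonempty (X.Geodesics o) := by
  classical
  have : ∀ v, ∃ g : (ℕ → V) × ℕ, X.Conn o v → X.Geo g.1 g.2 ∧ g.1 0 = o ∧ g.1 g.2 = v := by
    intro v
    by_cases hc : X.Conn o v
    · obtain ⟨g, n, h⟩ := exists_geo hc
      exact ⟨(g, n), fun _ => h⟩
    · exact ⟨(fun _ => o, 0), fun h => absurd h hc⟩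
  choose g hg using this
  exact ⟨⟨fun v => (g v).1, fun v => (g v).2, fun {v} h => (hg v h).1, fun {v} h => (hg v h).2.1,
    fun {v} h => (hg v h).2.2⟩⟩

/-- A sequence of vertices leaves every finite set, along a fixed free ultrafilter. -/
def Escapes (w : ℕ → V) : Prop := ∀ F : Set V, F.Finite → ∀ᶠ n in hyperfilter ℕ, w n ∉ F

/-- The chosen geodesics to the vertices `w n` converge to `ξ` along a fixed free ultrafilter. -/
def IsLimit {o : V} (G : X.Geodesics o) (ξ w : ℕ → V) : Prop :=
  ∀ t, ∀ᶠ n in hyperfilter ℕ, t ≤ G.len (w n) ∧ G.path (w n) t = ξ t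

variable {o : V} {G : X.Geodesics o} {δ : ℕ}

/-- A form of Kőnig's lemma: the `t`-th vertices lie in a finite ball, so the ultrafilter selects
one of them. -/
theorem exists_limit (G : X.Geodesics o) (hf : X.FinBalls) {w : ℕ → V}
    (hw : ∀ᶠ n in hyperfilter ℕ, X.Conn o (w n)) (he : Escapes w) :
    ∃ ξ, X.GeoRay ξ ∧ ξ 0 = o ∧ IsLimit G ξ w := by
  have h1 : ∀ t, ∀ᶠ n in hyperfilter ℕ, t ≤ G.len (w n) := by
    intro t
    filter_upwards [hw, he _ (hf t o).1] with n hn hne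
    by_contra hlt
    refine hne ?_
    have := (G.geo hn).le (Nat.zero_le _) le_rfl
    rw [G.zero hn, G.last hn] at this
    exact X.mono this (by omega)
  have h2 : ∀ t, ∃ x, ∀ᶠ n in hyperfilter ℕ, G.path (w n) t = x := by
    intro t
    have : ∀ᶠ n in hyperfilter ℕ, ∃ x ∈ {y | X.W t o y}, G.path (w n) t = x := by
      filter_upwards [hw, h1 t] with n hn ht
      refine ⟨_, ?_, rfl⟩
      have := (G.geo hn).le (Nat.zero_le t) ht
      rwa [G.zero hn] at this
    obtain ⟨x, _, hx⟩ := (Ultrafilter.eventually_exists_mem_iff (hf t o).1).1 this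
    exact ⟨x, hx⟩
  choose ξ hξ using h2
  refine ⟨ξ, fun n => ⟨fun {i j} hij hj => ?_, fun {i j k} hij hj hk => ?_⟩, ?_,
    fun t => (h1 t).and (hξ t)⟩
  · obtain ⟨m, a, b, c, d⟩ := (hw.and ((h1 j).and ((hξ i).and (hξ j)))).exists
    have := (G.geo a).le hij b
    rwa [c, d] at this
  · obtain ⟨m, a, b, c, d⟩ := (hw.and ((h1 j).and ((hξ i).and (hξ j)))).exists
    exact (G.geo a).ge hij b (k := k) (by rwa [c, d])
  · obtain ⟨m, a, b⟩ := (hw.and (hξ 0)).exists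
    rw [← b, G.zero a]

theorem Hyp.close_of_adjacent (h : X.Hyp δ) (hf : X.FinBalls) {ξ ζ x y : ℕ → V}
    (hx : ∀ᶠ n in hyperfilter ℕ, X.Conn o (x n)) (hy : ∀ᶠ n in hyperfilter ℕ, X.Conn o (y n))
    (hxe : Escapes x) (hye : Escapes y) (hξ : IsLimit G ξ x) (hζ : IsLimit G ζ y)
    (hxy : ∀ᶠ n in hyperfilter ℕ, X.W 1 (x n) (y n) ∨ X.W 1 (y n) (x n)) : X.Close δ ξ ζ := by
  classical
  intro t
  -- Thinness yields an uncontrolled position `j` on the geodesic to `y n`. Finiteness of the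
  -- in-ball of `ξ t` gives a bound `N` for `j` before `n` is chosen, so that the geodesic already
  -- agrees with `ζ` there.
  obtain ⟨N, hN⟩ : ∃ N, ∀ b, X.W δ b (ξ t) → X.Conn o b → X.W N o b := by
    have hfin := (hf δ (ξ t)).2
    have hex : ∀ b, ∃ k, X.Conn o b → X.W k o b := fun b => by
      by_cases hc : X.Conn o b
      · exact hc.imp fun k hk _ => hk
      · exact ⟨0, fun h => absurd h hc⟩
    choose f hf using hex
    refine ⟨hfin.toFinset.sup f, fun b hb hc => X.mono (hf b hc) ?_⟩
    exact Finset.le_sup (f := f) (by simpa using hb)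
  obtain ⟨n, hnx, hny, ⟨ht, htξ⟩, hs, ⟨hbx, hby⟩, hadj⟩ := (hx.and (hy.and ((hξ t).and
    (((eventually_all_finite (Set.finite_Iic N)).2 fun s _ => hζ s).and
    (((hxe _ (hf (δ + 1) (ξ t)).1).and (hye _ (hf (δ + 1) (ξ t)).1)).and hxy))))).exists
  obtain ⟨u, l, hu, hul⟩ : ∃ u l, X.GeoBetween u l (x n) (y n) ∧
      ∀ j ≤ l, X.W 1 (u j) (x n) ∨ X.W 1 (u j) (y n) := by
    rcases hadj with e | e
    · obtain ⟨u, l, hu, u0, ul⟩ := exists_geo ⟨_, e⟩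
      have hl := hu.length_le u0 ul e
      exact ⟨u, l, ⟨hu, Or.inl ⟨u0, ul⟩⟩, fun j hj => Or.inr
        (ul ▸ X.mono (hu.le hj le_rfl) (by omega))⟩
    · obtain ⟨u, l, hu, u0, ul⟩ := exists_geo ⟨_, e⟩
      have hl := hu.length_le u0 ul e
      exact ⟨u, l, ⟨hu, Or.inr ⟨u0, ul⟩⟩, fun j hj => Or.inl
        (ul ▸ X.mono (hu.le hj le_rfl) (by omega))⟩
  have hq : X.GeoBetween (G.path (y n)) (G.len (y n)) (G.path (x n) 0) (y n) :=
    ⟨G.geo hny, Or.inl ⟨by rw [G.zero hnx, G.zero hny], G.last hny⟩⟩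
  rw [← htξ] at hN hbx hby ⊢
  rcases h _ _ u _ _ l (y n) (G.geo hnx) hq (by rwa [G.last hnx]) t ht with
    ⟨j, hj, hw⟩ | ⟨j, hj, hw⟩
  · have h1 := (G.geo hny).le (Nat.zero_le j) hj
    rw [G.zero hny] at h1
    have h2 := hN _ hw ⟨_, h1⟩
    have h3 := (G.geo hny).ge (Nat.zero_le j) hj (k := N) (by rwa [G.zero hny])
    exact ⟨j, (hs j (by simpa using h3)).2 ▸ hw⟩
  · rcases hul j hj with e | e
    · exact absurd (X.trans hw e) hbx
    · exact absurd (X.trans hw e) hby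

/-- Up to closeness there are only finitely many geodesic rays from `o`. -/
def FinRays (X : StepMetric V) (o : V) : Prop :=
  ∃ s : Set (ℕ → V), s.Finite ∧ (∀ ρ ∈ s, X.GeoRay ρ ∧ ρ 0 = o) ∧
    ∀ ξ, X.GeoRay ξ → ξ 0 = o → ∃ ρ ∈ s, X.BLE (Set.range ρ) (Set.range ξ)

open Classical in
/-- The length up to which the chosen geodesic to `v` is close to `ρ`. -/
noncomputable def depth (G : X.Geodesics o) (δ : ℕ) (v : V) (ρ : ℕ → V) : ℕ :=
  Nat.findGreatest (fun m => ∀ t ≤ m, ∃ s, X.W δ (ρ s) (G.path v t)) (G.len v)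

/-- Each vertex gets a representative of maximal `depth`. Some representative follows the limit ray
forever, so the depths of the chosen ones are unbounded along the ultrafilter. -/
theorem Hyp.exists_colouring (h : X.Hyp δ) (hf : X.FinBalls) (G : X.Geodesics o)
    (hfin : X.FinRays o) (hne : ∃ ξ, X.GeoRay ξ ∧ ξ 0 = o) :
    ∃ (s : Set (ℕ → V)) (χ : V → ℕ → V), s.Finite ∧ (∀ ρ ∈ s, X.GeoRay ρ ∧ ρ 0 = o) ∧
      (∀ v, χ v ∈ s) ∧ ∀ w ξ ρ, (∀ᶠ n in hyperfilter ℕ, X.Conn o (w n)) → X.GeoRay ξ → ξ 0 = o →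
        IsLimit G ξ w → (∀ᶠ n in hyperfilter ℕ, χ (w n) = ρ) → X.Close δ ξ ρ := by
  classical
  obtain ⟨s, hs, hray, hrep⟩ := hfin
  have hsne : s.Nonempty := by
    obtain ⟨ξ, h1, h2⟩ := hne
    obtain ⟨ρ, hρ, _⟩ := hrep ξ h1 h2
    exact ⟨ρ, hρ⟩
  have := fun v => Set.exists_max_image s (depth G δ v) hs hsne
  choose χ hχs hχ using this
  refine ⟨s, χ, hs, hray, hχs, fun w ξ ρ hw hξ hξ0 hlim hcol t => ?_⟩
  obtain ⟨ρ', hρ', hb⟩ := hrep ξ hξ hξ0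
  have hc := (h.close_of_ble hf (hray ρ' hρ').1 hξ ((hray ρ' hρ').2.trans hξ0.symm) hb).2
  obtain ⟨n, hn, hnρ, hs⟩ := (hw.and (hcol.and
    ((eventually_all_finite (Set.finite_Iic t)).2 fun s _ => hlim s))).exists
  have hlen := (hs t (by simp)).1
  have h1 : t ≤ depth G δ (w n) ρ' := Nat.le_findGreatest hlen fun i hi => by
    rw [(hs i (by simpa using hi)).2]
    exact hc i
  have h2 : t ≤ depth G δ (w n) ρ := h1.trans (hnρ ▸ hχ (w n) ρ' hρ')
  have hρs : ρ ∈ s := hnρ ▸ hχs _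
  have h3 := Nat.findGreatest_spec
    (P := fun m => ∀ t ≤ m, ∃ s, X.W δ (ρ s) (G.path (w n) t)) (Nat.zero_le (G.len (w n))) (by
      intro i hi
      obtain rfl : i = 0 := by omega
      exact ⟨0, by rw [(hray ρ hρs).2, G.zero hn]; exact X.mono (X.refl _) (Nat.zero_le _)⟩)
  obtain ⟨a, ha⟩ := h3 t h2
  exact ⟨a, (hs t (by simp)).2 ▸ ha⟩

/-- A vertex lies on at most one of the paths, and a free ultrafilter ignores single indices. -/
theorem escapes_of_disjoint {v : ℕ → ℕ → V} {ℓ i : ℕ → ℕ}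
    (hd : ∀ m n, m ≠ n → ∀ i ≤ ℓ m, ∀ j ≤ ℓ n, v m i ≠ v n j)
    (hi : ∀ᶠ n in hyperfilter ℕ, i n ≤ ℓ n) : Escapes fun n => v n (i n) := by
  intro F hF
  by_contra hcon
  rw [← Ultrafilter.eventually_not] at hcon
  have : ∀ᶠ n in hyperfilter ℕ, ∃ b ∈ F, v n (i n) = b := by
    filter_upwards [hcon] with n hn
    exact ⟨_, not_not.1 hn, rfl⟩
  obtain ⟨b, _, hb⟩ := (Ultrafilter.eventually_exists_mem_iff hF).1 this
  obtain ⟨m, hm, hm'⟩ := (hb.and hi).exists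
  have hne : ∀ᶠ n in hyperfilter ℕ, n ∉ ({m} : Set ℕ) :=
    compl_mem_hyperfilter_of_finite (Set.finite_singleton m)
  obtain ⟨n, hn, hn', hnm⟩ := (hb.and (hi.and hne)).exists
  exact hd m n (fun e => hnm e.symm) _ hm' _ hn' (hm.trans hn.symm)

/-- If there are only finitely many geodesic rays up to closeness, then the limits of the first
and last vertices of disjoint paths are close. -/
theorem Hyp.exists_close_limits (h : X.Hyp δ) (hf : X.FinBalls) (G : X.Geodesics o)
    (hfin : X.FinRays o) {v : ℕ → ℕ → V} {ℓ : ℕ → ℕ}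
    (hv : ∀ n, ∀ i < ℓ n, X.W 1 (v n i) (v n (i + 1))) (hc : ∀ n, X.Conn o (v n 0))
    (hd : ∀ m n, m ≠ n → ∀ i ≤ ℓ m, ∀ j ≤ ℓ n, v m i ≠ v n j) :
    ∃ ξ ζ, X.GeoRay ξ ∧ X.GeoRay ζ ∧ IsLimit G ξ (fun n => v n 0) ∧
      IsLimit G ζ (fun n => v n (ℓ n)) ∧ X.Close δ ζ ξ := by
  classical
  have hconn : ∀ n, ∀ i ≤ ℓ n, X.Conn o (v n i) := fun n i hi =>
    (hc n).trans ⟨_, chain (X := X) (lam := 1) (Nat.zero_le i) fun t _ ht => hv n t (by omega)⟩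
  have lim : ∀ i : ℕ → ℕ, (∀ᶠ n in hyperfilter ℕ, i n ≤ ℓ n) →
      ∃ ξ, X.GeoRay ξ ∧ ξ 0 = o ∧ IsLimit G ξ (fun n => v n (i n)) := fun i hi =>
    exists_limit G hf (hi.mono fun n hn => hconn n _ hn) (escapes_of_disjoint hd hi)
  have z0 : ∀ᶠ n in hyperfilter ℕ, (0 : ℕ) ≤ ℓ n := Eventually.of_forall fun n => Nat.zero_le _
  have zl : ∀ᶠ n in hyperfilter ℕ, ℓ n ≤ ℓ n := Eventually.of_forall fun n => le_rfl
  obtain ⟨ξ, hξ, hξ0, hξl⟩ := lim (fun _ => 0) z0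
  obtain ⟨ζ, hζ, hζ0, hζl⟩ := lim ℓ zl
  refine ⟨ξ, ζ, hξ, hζ, hξl, hζl, ?_⟩
  obtain ⟨s, χ, hs, hray, hχs, hχ⟩ := h.exists_colouring hf G hfin ⟨ξ, hξ, hξ0⟩
  have colour : ∀ w : ℕ → V, ∃ ρ ∈ s, ∀ᶠ n in hyperfilter ℕ, χ (w n) = ρ := fun w =>
    (Ultrafilter.eventually_exists_mem_iff hs).1
      (Eventually.of_forall fun n => ⟨χ (w n), hχs _, rfl⟩)
  have trans : ∀ {a b c}, X.GeoRay a → X.GeoRay c → a 0 = o → c 0 = o → X.Close δ a b →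
      X.Close δ b c → X.Close δ a c := fun ha hc ha0 hc0 h1 h2 =>
    h1.trans h hf ha hc (ha0.trans hc0.symm) h2
  -- eventually, adjacent vertices on the paths have close colours
  have hmono : ∀ᶠ n in hyperfilter ℕ, ∀ i < ℓ n,
      X.Close δ (χ (v n (i + 1))) (χ (v n i)) := by
    by_contra hcon
    rw [← Ultrafilter.eventually_not] at hcon
    have : ∀ n, ∃ i, (¬ ∀ i < ℓ n, X.Close δ (χ (v n (i + 1))) (χ (v n i))) →
        i < ℓ n ∧ ¬ X.Close δ (χ (v n (i + 1))) (χ (v n i)) := by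
      intro n
      by_cases hn : ∀ i < ℓ n, X.Close δ (χ (v n (i + 1))) (χ (v n i))
      · exact ⟨0, fun h => absurd hn h⟩
      · push Not at hn
        obtain ⟨i, hi⟩ := hn
        exact ⟨i, fun _ => hi⟩
    -- The ends of the bad edges have limits `α` and `β`, close because the ends are adjacent. Their
    -- colours are eventually constant and close to these limits, hence to each other, which
    -- contradicts badness.
    choose i hi using this
    have hbad := hcon.mono fun n hn => hi n hn
    have e1 : ∀ᶠ n in hyperfilter ℕ, i n ≤ ℓ n := hbad.mono fun n hn => hn.1.le
    have e2 : ∀ᶠ n in hyperfilter ℕ, i n + 1 ≤ ℓ n := hbad.mono fun n hn => hn.1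
    obtain ⟨α, hα, hα0, hαl⟩ := lim i e1
    obtain ⟨β, hβ, hβ0, hβl⟩ := lim (fun n => i n + 1) e2
    have c1 := e1.mono fun n hn => hconn n _ hn
    have c2 := e2.mono fun n hn => hconn n _ hn
    have hβα : X.Close δ β α := h.close_of_adjacent hf c2 c1 (escapes_of_disjoint hd e2)
      (escapes_of_disjoint hd e1) hβl hαl (hbad.mono fun n hn => Or.inr (hv n _ hn.1))
    obtain ⟨ρ, hρ, hρc⟩ := colour fun n => v n (i n)
    obtain ⟨σ, hσ, hσc⟩ := colour fun n => v n (i n + 1)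
    have k1 := hχ _ _ _ c1 hα hα0 hαl hρc
    have k2 := hχ _ _ _ c2 hβ hβ0 hβl hσc
    have k3 := k2.symm h hf hβ (hray σ hσ).1 (hβ0.trans (hray σ hσ).2.symm)
    have k4 := trans (hray σ hσ).1 hα (hray σ hσ).2 hα0 k3 hβα
    have k5 := trans (hray σ hσ).1 (hray ρ hρ).1 (hray σ hσ).2 (hray ρ hρ).2 k4 k1
    obtain ⟨n, hn, hn1, hn2⟩ := (hbad.and (hρc.and hσc)).exists
    exact hn.2 (by rwa [hn1, hn2])
  have hends : ∀ᶠ n in hyperfilter ℕ, X.Close δ (χ (v n (ℓ n))) (χ (v n 0)) := by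
    filter_upwards [hmono] with n hn
    have : ∀ i ≤ ℓ n, X.Close δ (χ (v n i)) (χ (v n 0)) := by
      intro i
      induction i with
      | zero => exact fun _ => Close.refl _ _
      | succ i ih =>
        intro hi
        exact trans (hray _ (hχs _)).1 (hray _ (hχs _)).1 (hray _ (hχs _)).2 (hray _ (hχs _)).2
          (hn i hi) (ih (by omega))
    exact this _ le_rfl
  obtain ⟨ρ, hρ, hρc⟩ := colour fun n => v n 0
  obtain ⟨σ, hσ, hσc⟩ := colour fun n => v n (ℓ n)
  have k1 := hχ _ _ _ (z0.mono fun n hn => hconn n _ hn) hξ hξ0 hξl hρc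
  have k2 := hχ _ _ _ (zl.mono fun n hn => hconn n _ hn) hζ hζ0 hζl hσc
  have k3 := k1.symm h hf hξ (hray ρ hρ).1 (hξ0.trans (hray ρ hρ).2.symm)
  obtain ⟨n, hn, hn1, hn2⟩ := (hends.and (hρc.and hσc)).exists
  rw [hn1, hn2] at hn
  exact trans hζ hξ hζ0 hξ0 k2 (trans (hray σ hσ).1 hξ (hray σ hσ).2 hξ0 hn k3)

end StepMetric
end DigraphBoundary

/-! ### From disjoint paths to short paths. -/

namespace DigraphBoundary
namespace StepMetric

open Filter

variable {V : Type*} {X : StepMetric V} {δ C : ℕ}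

/-- A quasi-geodesic ray with edges as steps. -/
def QuasiRay (X : StepMetric V) (R : ℕ → V) (γ c : ℕ) : Prop := ∀ N, X.Quasi R N 1 γ c

theorem QuasiRay.tail {R : ℕ → V} {γ c : ℕ} (h : X.QuasiRay R γ c) (k : ℕ) :
    X.QuasiRay (fun i => R (k + i)) γ c := fun N =>
  ⟨fun hi => (h (k + N)).step (by omega), fun {i j _} hij hj hk => by
    have := (h (k + N)).ge (i := k + i) (j := k + j) (by omega) (by omega) hk
    omega⟩

/-- Infinitely many disjoint paths from `A` to `B`. -/
structure PathFamily (X : StepMetric V) (A B : Set V) (v : ℕ → ℕ → V) (ℓ : ℕ → ℕ) : Prop where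
  step : ∀ n, ∀ i < ℓ n, X.W 1 (v n i) (v n (i + 1))
  first : ∀ n, v n 0 ∈ A
  last : ∀ n, v n (ℓ n) ∈ B
  disj : ∀ m n, m ≠ n → ∀ i ≤ ℓ m, ∀ j ≤ ℓ n, v m i ≠ v n j

theorem PathFamily.conn {A B : Set V} {v : ℕ → ℕ → V} {ℓ : ℕ → ℕ} (h : X.PathFamily A B v ℓ)
    (n : ℕ) : X.Conn (v n 0) (v n (ℓ n)) :=
  ⟨_, chain (X := X) (lam := 1) (Nat.zero_le _) fun t _ ht => h.step n t ht⟩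

theorem PathFamily.reverse {A B : Set V} {v : ℕ → ℕ → V} {ℓ : ℕ → ℕ} (h : X.PathFamily A B v ℓ) :
    X.rev.PathFamily B A (fun n i => v n (ℓ n - i)) ℓ where
  step n i hi := by
    have := h.step n (ℓ n - (i + 1)) (by omega)
    rwa [show ℓ n - (i + 1) + 1 = ℓ n - i by omega] at this
  first n := by simpa using h.last n
  last n := by simpa using h.first n
  disj m n hmn i hi j hj := h.disj m n hmn _ (by omega) _ (by omega)

/-- Disjoint paths starting at a quasi-geodesic ray yield short paths to a limit ray. -/
theorem IsHyp.ble_of_pathFamily (h : X.IsHyp δ C) (hf : X.FinBalls) {R₁ R₂ : ℕ → V}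
    {γ₁ c₁ γ₂ c₂ : ℕ} (h₁ : X.QuasiRay R₁ γ₁ c₁)
    (h₂ : X.QuasiRay R₂ γ₂ c₂ ∨ X.rev.QuasiRay R₂ γ₂ c₂) (hfin : X.FinRays (R₁ 0))
    {v : ℕ → ℕ → V} {ℓ : ℕ → ℕ} (hv : X.PathFamily (Set.range R₁) (Set.range R₂) v ℓ) :
    X.BLE (Set.range R₁) (Set.range R₂) := by
  obtain ⟨G⟩ := exists_geodesics X (R₁ 0)
  have hc0 : ∀ n, X.Conn (R₁ 0) (v n 0) := fun n => by
    obtain ⟨k, hk⟩ := hv.first n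
    exact hk ▸ (h₁ k).conn (Nat.zero_le k) le_rfl
  have hcl : ∀ n, X.Conn (R₁ 0) (v n (ℓ n)) := fun n => (hc0 n).trans (hv.conn n)
  obtain ⟨ξ, ζ, hξ, hζ, hξl, hζl, hcl'⟩ :=
    h.hyp.exists_close_limits hf G hfin hv.step hc0 hv.disj
  have hesc : Escapes fun n => v n (ℓ n) :=
    escapes_of_disjoint hv.disj (Eventually.of_forall fun n => le_rfl)
  obtain ⟨κ₁, hκ₁⟩ := IsHyp.exists_stability δ C 1 γ₁ c₁
  obtain ⟨κ₂, hκ₂⟩ := IsHyp.exists_stability δ C 1 γ₂ c₂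
  -- Every `ξ s` lies on a geodesic between two vertices of `R₁`, hence near `R₁` by stability, and
  -- `ζ` is close to `ξ`.
  have hA : ∀ t, ∃ u ∈ Set.range R₁, X.W (κ₁ + δ) u (ζ t) := by
    intro t
    obtain ⟨s, hs⟩ := hcl' t
    obtain ⟨n, hn, hn'⟩ := (hξl s).exists
    obtain ⟨k, hk⟩ := hv.first n
    obtain ⟨a, _, ha⟩ := (@hκ₁ V X h _ _ (h₁ k) _ _ (G.geo (hc0 n)) (G.zero (hc0 n))
      ((G.last (hc0 n)).trans hk.symm) s hn).2
    exact ⟨_, ⟨a, rfl⟩, X.trans ha (hn' ▸ hs)⟩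
  rcases h₂ with h₂ | h₂
  · obtain ⟨k₀, hk₀⟩ := hv.last 0
    have hL := hcl 0
    -- Triangle on `R₁ 0`, `R₂ k₀`, `R₂ k`: the side to `R₂ k₀` is fixed, so only finitely many `ζ
    -- t` are close to it. The others are close to a geodesic between vertices of `R₂`, hence to
    -- `R₂`.
    refine BLE.of_injective (M' := thinConst δ C + κ₂) hf hζ.injective (hf.into (thinConst δ C)
      ((Set.finite_Iic (G.len (v 0 (ℓ 0)))).image (G.path (v 0 (ℓ 0))))) hA fun t ht => ?_
    obtain ⟨n, ⟨hn, hn'⟩, hesc'⟩ := ((hζl t).and (hesc _ ((Set.finite_Iio k₀).image R₂))).exists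
    obtain ⟨k, hk⟩ := hv.last n
    have hkk : k₀ ≤ k := by
      by_contra hlt
      exact hesc' ⟨k, by simpa using hlt, hk⟩
    obtain ⟨r, l, hr, r0, rl⟩ := exists_geo ((h₂ k).conn hkk le_rfl)
    rcases h.thin (G.geo (hcl n)) (G.geo hL) hr (by rw [G.zero hL, G.zero (hcl n)])
      (by rw [G.last hL, r0, hk₀]) (by rw [rl, hk, G.last (hcl n)]) hn with ⟨j, hj, hw⟩ | ⟨j, hj, hw⟩
    · exact absurd ⟨_, ⟨j, hj, rfl⟩, hn' ▸ hw⟩ ht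
    · obtain ⟨a, _, ha⟩ := (@hκ₂ V X h _ _ (h₂.tail k₀ (k - k₀)) _ _ hr r0
        (by rw [rl, Nat.add_sub_cancel' hkk]) j hj).1
      exact ⟨_, ⟨k₀ + a, rfl⟩, X.trans (hn' ▸ hw) ha⟩
  · have hR : ∀ k, X.Conn (R₂ k) (R₂ 0) := fun k => (h₂ k).conn (Nat.zero_le k) le_rfl
    have hL : X.Conn (R₁ 0) (R₂ 0) := by
      obtain ⟨k, hk⟩ := hv.last 0
      exact (hcl 0).trans (hk ▸ hR k)
    -- For an anti-ray the side at `R₂ k` points towards the fixed corner `R₂ 0`. The triangle is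
    -- not consistently directed for `IsHyp.thin`, but `Hyp` gives the needed direction at the end
    -- vertex.
    refine BLE.of_injective (M' := δ + κ₂) hf hζ.injective (hf.out δ
      ((Set.finite_Iic (G.len (R₂ 0))).image (G.path (R₂ 0)))) hA fun t ht => ?_
    obtain ⟨n, hn, hn'⟩ := (hζl t).exists
    obtain ⟨k, hk⟩ := hv.last n
    obtain ⟨r, l, hr, r0, rl⟩ := exists_geo (hR k)
    rcases h.hyp _ _ r _ _ l (R₂ 0) (G.geo (hcl n))
      ⟨G.geo hL, Or.inl ⟨by rw [G.zero hL, G.zero (hcl n)], G.last hL⟩⟩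
      ⟨hr, Or.inl ⟨by rw [r0, hk, G.last (hcl n)], rl⟩⟩ t hn with ⟨j, hj, hw⟩ | ⟨j, hj, hw⟩
    · exact absurd ⟨_, ⟨j, hj, rfl⟩, hn' ▸ hw⟩ ht
    · obtain ⟨a, _, ha⟩ := (@hκ₂ V X h _ _ (h₂ k).reverse _ _ hr (by simpa using r0)
        (by simpa using rl) j hj).1
      exact ⟨_, ⟨k - a, rfl⟩, X.trans (hn' ▸ hw) ha⟩

/-- If an anti-ray has short paths from a ray, and there is some path from the anti-ray to the ray,
then it has short paths to the ray. -/
theorem IsHyp.ble_symm (h : X.IsHyp δ C) (hf : X.FinBalls) {R₁ R₂ : ℕ → V} {γ₁ c₁ γ₂ c₂ : ℕ}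
    (h₁ : X.rev.QuasiRay R₁ γ₁ c₁) (h₂ : X.QuasiRay R₂ γ₂ c₂) {a b : ℕ}
    (hab : X.Conn (R₁ a) (R₂ b)) (hb : X.BLE (Set.range R₂) (Set.range R₁)) :
    X.BLE (Set.range R₁) (Set.range R₂) := by
  obtain ⟨M, hM⟩ := hb.avoid hf
  refine ⟨C * (0 + M + 1), fun F hF => ?_⟩
  obtain ⟨_, ⟨j, rfl⟩, _, ⟨i, rfl⟩, hj, hi, hW⟩ := hM
    (F ∪ (R₁ '' Set.Iio a ∪ R₂ '' Set.Iio b))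
    (hF.union (((Set.finite_Iio a).image _).union ((Set.finite_Iio b).image _)))
  simp only [Set.mem_union, Set.mem_image, Set.mem_Iio, not_or, not_exists, not_and] at hj hi
  have hia : a ≤ i := by
    by_contra hlt
    exact hi.2.1 i (by omega) rfl
  have hjb : b ≤ j := by
    by_contra hlt
    exact hj.2.2 j (by omega) rfl
  have hc : X.Conn (R₁ i) (R₂ j) := Conn.trans ((h₁ i).conn hia le_rfl)
    (hab.trans ((h₂ j).conn hjb le_rfl))
  refine ⟨_, ⟨i, rfl⟩, _, ⟨j, rfl⟩, hi.1, ?_⟩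
  have := h.fork hW (X.refl _) hc
  exact X.mono this (by rw [Nat.add_zero, Nat.zero_add])

/-- An injective sequence of edges yields a geodesic ray. -/
theorem exists_geoRay (hf : X.FinBalls) {R : ℕ → V} (hR : Function.Injective R)
    (hs : ∀ i, X.W 1 (R i) (R (i + 1))) : ∃ ξ, X.GeoRay ξ := by
  obtain ⟨G⟩ := exists_geodesics X (R 0)
  have hesc : Escapes R := escapes_of_disjoint (v := fun n _ => R n) (ℓ := fun _ => 0)
    (i := fun _ => 0) (fun m n hmn _ _ _ _ e => hmn (hR e)) (Eventually.of_forall fun n => le_rfl)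
  obtain ⟨ξ, hξ, _⟩ := exists_limit G hf (Eventually.of_forall fun n =>
    ⟨_, chain (X := X) (lam := 1) (Nat.zero_le n) fun t _ _ => hs t⟩) hesc
  exact ⟨ξ, hξ⟩

end StepMetric

/-! ### Translation between digraphs and their distances. -/

open StepMetric

variable {V : Type*} {D : Digraph V}

theorem dist_le_iff {x y : V} {n : ℕ} :
    dist D x y ≤ n ↔ ∃ P : DiPath D, P.first = x ∧ P.last = y ∧ P.length ≤ n := by
  constructor
  · intro h
    by_contra hcon
    push Not at hcon
    have : ((n + 1 : ℕ) : ℕ∞) ≤ dist D x y :=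
      le_iInf₂ fun P hP => by exact_mod_cast hcon P hP.1 hP.2
    have := this.trans h
    norm_cast at this
    omega
  · rintro ⟨P, h1, h2, h3⟩
    exact (iInf₂_le P ⟨h1, h2⟩).trans (by exact_mod_cast h3)

theorem DiPath.dist_le (P : DiPath D) {i j : ℕ} (hij : i ≤ j) (hj : j ≤ P.length) :
    dist D (P.vert i) (P.vert j) ≤ (j - i : ℕ) :=
  dist_le_iff.2 ⟨⟨j - i, fun t => P.vert (i + t), fun t ht => P.adj (i + t) (by omega)⟩, rfl,
    by simp [DiPath.last, Nat.add_sub_cancel' hij], le_rfl⟩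

/-- The distance of a digraph. -/
noncomputable def ofDigraph (D : Digraph V) : StepMetric V where
  W n x y := dist D x y ≤ n
  refl x := dist_le_iff.2 ⟨⟨0, fun _ => x, by simp⟩, rfl, rfl, le_rfl⟩
  eq_of_zero {x y} h := by
    obtain ⟨P, h1, h2, h3⟩ := dist_le_iff.1 h
    rw [← h1, ← h2, DiPath.last, Nat.le_zero.1 h3, DiPath.first]
  split {m n x y} h := by
    obtain ⟨P, h1, h2, h3⟩ := dist_le_iff.1 h
    refine ⟨P.vert (min m P.length), ?_, ?_⟩
    · have := P.dist_le (Nat.zero_le (min m P.length)) (min_le_right _ _)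
      rw [show P.vert 0 = x from h1] at this
      exact this.trans (by norm_cast; omega)
    · have := P.dist_le (min_le_right m P.length) le_rfl
      rw [show P.vert P.length = y from h2] at this
      exact this.trans (by norm_cast; omega)
  trans {m n x y z} h1 h2 := by
    obtain ⟨P, p1, p2, p3⟩ := dist_le_iff.1 h1
    obtain ⟨Q, q1, q2, q3⟩ := dist_le_iff.1 h2
    have e : P.vert P.length = Q.vert 0 := p2.trans q1.symm
    refine dist_le_iff.2 ⟨⟨P.length + Q.length, fun i => if i ≤ P.length then P.vert i else
      Q.vert (i - P.length), fun i hi => ?_⟩, ?_, ?_, Nat.add_le_add p3 q3⟩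
    · rcases Nat.lt_trichotomy i P.length with h | h | h
      · simpa [h.le, Nat.succ_le_of_lt h] using P.adj i h
      · subst h
        simpa [e] using Q.adj 0 (by omega)
      · have := Q.adj (i - P.length) (by omega)
        rw [show i - P.length + 1 = i + 1 - P.length by omega] at this
        simpa [show ¬ i ≤ P.length by omega, show ¬ i + 1 ≤ P.length by omega] using this
    · simpa [DiPath.first] using p1
    · by_cases h0 : Q.length = 0
      · simp only [DiPath.last, h0, Nat.add_zero, le_refl, if_true]
        rw [e, ← q2, DiPath.last, h0]
      · simpa [DiPath.last, h0] using q2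
  mono h hmn := h.trans (by exact_mod_cast hmn)

theorem conn_iff {x y : V} : (ofDigraph D).Conn x y ↔ dist D x y ≠ ⊤ := by
  constructor
  · rintro ⟨k, hk⟩ h
    have : dist D x y ≤ k := hk
    simp [h] at this
  · intro h
    obtain ⟨k, hk⟩ := ENat.ne_top_iff_exists.1 h
    exact ⟨k, hk.symm.le⟩

theorem le_dist {x y : V} {n : ℕ} (h : ∀ k, (ofDigraph D).W k x y → n ≤ k) :
    (n : ℕ∞) ≤ dist D x y := by
  by_cases ht : dist D x y = ⊤
  · simp [ht]
  · obtain ⟨k, hk⟩ := ENat.ne_top_iff_exists.1 ht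
    rw [← hk]
    exact_mod_cast h k hk.symm.le

theorem w_one_of_adj {x y : V} (h : D.Adj x y) : (ofDigraph D).W 1 x y :=
  dist_le_iff.2 ⟨⟨1, fun i => if i = 0 then x else y, fun i hi => by
    obtain rfl : i = 0 := by omega
    simpa using h⟩, by simp [DiPath.first], by simp [DiPath.last], le_rfl⟩

theorem eq_or_adj_of_w_one {x y : V} (h : (ofDigraph D).W 1 x y) : x = y ∨ D.Adj x y := by
  obtain ⟨P, h1, h2, h3⟩ := dist_le_iff.1 h
  rcases Nat.eq_zero_or_pos P.length with h0 | h0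
  · left
    rw [← h1, ← h2, DiPath.first, DiPath.last, h0]
  · right
    have hl : P.length = 1 := by omega
    have := P.adj 0 h0
    rwa [← h1, ← h2, DiPath.first, DiPath.last, hl]

theorem adj_of_geo {g : ℕ → V} {n i : ℕ} (h : (ofDigraph D).Geo g n) (hi : i < n) :
    D.Adj (g i) (g (i + 1)) := by
  have := h.le (Nat.le_succ i) hi
  rw [show i.succ - i = 1 by omega] at this
  refine (eq_or_adj_of_w_one this).resolve_left fun e => ?_
  have := h.inj hi.le hi e
  omega

/-- A geodesic as a directed path. -/
def geoPath {g : ℕ → V} {n : ℕ} (h : (ofDigraph D).Geo g n) : DiPath D where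
  length := n
  vert := g
  adj _ hi := adj_of_geo h hi

theorem geoPath_isGeodesic {g : ℕ → V} {n : ℕ} (h : (ofDigraph D).Geo g n) :
    (geoPath h).IsGeodesic :=
  le_antisymm (le_dist fun _ hk => h.length_le rfl rfl hk) (h.le (Nat.zero_le n) le_rfl)

theorem IsDeltaHyperbolic.hyp {δ : ℕ} (h : IsDeltaHyperbolic D δ) : (ofDigraph D).Hyp δ := by
  intro p q r n m l c hp hq hr i hi
  have := h (p 0) (p n) c (geoPath hp) (geoPath hq.1) (geoPath hr.1) (geoPath_isGeodesic hp) rfl rfl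
    ⟨geoPath_isGeodesic hq.1, hq.2⟩ ⟨geoPath_isGeodesic hr.1, hr.2⟩ ⟨i, hi, rfl⟩
  rcases this with h | h <;> obtain ⟨_, ⟨j, hj, rfl⟩, hw⟩ := Set.mem_iUnion₂.1 h
  · exact Or.inl ⟨j, hj, hw⟩
  · exact Or.inr ⟨j, hj, hw⟩

/-! ### Finiteness conditions -/

theorem finBalls_of_one {X : StepMetric V} (h : ∀ x, {y | X.W 1 x y}.Finite) (k : ℕ) (x : V) :
    {y | X.W k x y}.Finite := by
  induction k with
  | zero => exact (Set.finite_singleton x).subset fun y hy => (X.eq_of_zero hy).symm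
  | succ k ih =>
    refine (ih.biUnion fun z _ => h z).subset fun y hy => ?_
    obtain ⟨z, h1, h2⟩ := X.split hy
    exact Set.mem_biUnion h1 h2

theorem IsLocallyFinite.finBalls (h : IsLocallyFinite D) : (ofDigraph D).FinBalls := by
  have key : ∀ x y, (ofDigraph D).W 1 x y → y = x ∨ dist D x y = 1 := by
    intro x y hw
    by_cases h0 : dist D x y = 0
    · exact Or.inl ((ofDigraph D).eq_of_zero (x := x) (y := y) (by simp [ofDigraph, h0])).symm
    · exact Or.inr (le_antisymm hw (Order.one_le_iff_ne_zero.2 h0))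
  intro k x
  refine ⟨finBalls_of_one (fun x => ?_) k x, finBalls_of_one (X := (ofDigraph D).rev) (fun x => ?_) k x⟩
  · exact ((h x).1.insert x).subset fun y hy => key x y hy
  · exact ((h x).2.insert x).subset fun y hy => (key y x hy).imp_left Eq.symm

/-- On a geodesic, the positions of any two vertices in the ball differ by at most `F`. -/
theorem fiberBound_of_fork {X : StepMetric V} {δ F : ℕ}
    (h : ∀ x y z, X.W δ x y → X.W δ x z → X.Conn y z → X.W F y z) : X.FiberBound δ (F + 1) := by
  intro g n x s hg hs
  rcases s.eq_empty_or_nonempty with rfl | hne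
  · simp
  have hsub : s ⊆ Finset.Icc (s.min' hne) (s.min' hne + F) := by
    intro i hi
    have hm := hs _ (s.min'_mem hne)
    have hle := s.min'_le i hi
    have := hg.ge hle (hs i hi).1 (h x _ _ hm.2 (hs i hi).2 (hg.conn hle (hs i hi).1))
    rw [Finset.mem_Icc]
    omega
  have := Finset.card_le_card hsub
  rw [Nat.card_Icc] at this
  omega

theorem fiberBound_of_card {X : StepMetric V} {δ N : ℕ}
    (h : ∀ x, ∃ b : Finset V, b.card ≤ N ∧ ∀ y, X.W δ x y → y ∈ b) : X.FiberBound δ N := by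
  classical
  intro g n x s hg hs
  obtain ⟨b, hb, hmem⟩ := h x
  refine le_trans ?_ hb
  rw [← Finset.card_image_of_injOn (f := g) fun i hi j hj e => hg.inj (hs i hi).1 (hs j hj).1 e]
  refine Finset.card_le_card fun y hy => ?_
  obtain ⟨i, hi, rfl⟩ := Finset.mem_image.1 hy
  exact hmem _ (hs i hi).2

/-- Only the bounds at radius `δ` enter; thinness extends them to linear bounds at all radii. -/
theorem IsDeltaHyperbolic.isHyp {δ : ℕ} (h : IsDeltaHyperbolic D δ) (h1 : BoundedOutBalls D)
    (h2 : BoundedInBalls D) : ∃ C, (ofDigraph D).IsHyp δ C := by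
  obtain ⟨f₁, hf₁⟩ := h1
  obtain ⟨f₂, hf₂⟩ := h2
  have mono : ∀ {X : StepMetric V} {a b}, X.FiberBound δ a → a ≤ b → X.FiberBound δ b :=
    fun h hab g n x s hg hs => (h g n x s hg hs).trans hab
  refine ⟨_, h.hyp.isHyp (mono (fiberBound_of_fork (F := f₁ δ) fun x y z hy hz hc => ?_)
    (le_max_left _ (f₂ δ + 1))) (mono (fiberBound_of_fork (F := f₂ δ) fun x y z hy hz hc => ?_)
    (le_max_right _ _))⟩
  · exact (hf₁ x δ y hy z hz).resolve_left (conn_iff.1 hc)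
  · exact (hf₂ x δ z hz y hy).resolve_left (conn_iff.1 hc)

/-! ### Rays -/

/-- The vertices of a ray or anti-ray. -/
def RayOrAntiRay.seq : RayOrAntiRay D → ℕ → V
  | .inl R => R.vert
  | .inr R => R.vert

theorem RayOrAntiRay.support_eq (R : RayOrAntiRay D) : R.support = Set.range R.seq := by
  cases R <;> rfl

theorem RayOrAntiRay.seq_injective (R : RayOrAntiRay D) : Function.Injective R.seq := by
  rcases R with R | R
  · exact R.inj
  · exact R.inj

theorem quasi_of_dist {γ c i j k : ℕ} {x y : V} (hk : (ofDigraph D).W k x y)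
    (h : ((j - i : ℕ) : ℕ∞) ≤ γ * dist D x y + c) : j - i ≤ γ * k + c := by
  have hk' : dist D x y ≤ k := hk
  have : ((j - i : ℕ) : ℕ∞) ≤ γ * (k : ℕ∞) + c := h.trans (by gcongr)
  exact_mod_cast this

theorem Ray.quasiRay {R : Ray D} (h : RayOrAntiRay.IsQuasiGeodesic (.inl R)) :
    ∃ γ c, (ofDigraph D).QuasiRay R.vert γ c := by
  obtain ⟨γ, c, _, h⟩ := h
  exact ⟨γ, c, fun N => ⟨fun _ => w_one_of_adj (R.adj _), fun {i j k} hij _ hk =>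
    quasi_of_dist hk (h i j hij)⟩⟩

theorem AntiRay.quasiRay {R : AntiRay D} (h : RayOrAntiRay.IsQuasiGeodesic (.inr R)) :
    ∃ γ c, (ofDigraph D).rev.QuasiRay R.vert γ c := by
  obtain ⟨γ, c, _, h⟩ := h
  exact ⟨γ, c, fun N => ⟨fun _ => w_one_of_adj (R.adj _), fun {i j k} hij _ hk =>
    quasi_of_dist hk (h i j hij)⟩⟩

/-- A geodesic ray as a quasi-geodesic ray. -/
def ofGeoRay {ρ : ℕ → V} (h : (ofDigraph D).GeoRay ρ) : QuasiGeodesicRay D :=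
  ⟨.inl ⟨ρ, h.injective, fun i => adj_of_geo (h (i + 1)) (Nat.lt_succ_self i)⟩, 1, 0, le_rfl,
    fun i j hij => by
      simpa using le_dist fun k hk => (h j).ge hij le_rfl hk⟩

theorem adj_of_rev_geoRay {ρ : ℕ → V} (h : (ofDigraph D).rev.GeoRay ρ) (i : ℕ) :
    D.Adj (ρ (i + 1)) (ρ i) := by
  have := (h (i + 1)).le (Nat.le_succ i) le_rfl
  rw [show i.succ - i = 1 by omega] at this
  refine (eq_or_adj_of_w_one this).resolve_left fun e => ?_
  have := h.injective e
  omega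

/-- A geodesic ray for the reversed distance as a quasi-geodesic anti-ray. -/
def ofRevGeoRay {ρ : ℕ → V} (h : (ofDigraph D).rev.GeoRay ρ) : QuasiGeodesicRay D :=
  ⟨.inr ⟨ρ, h.injective, adj_of_rev_geoRay h⟩, 1, 0, le_rfl, fun i j hij => by
    simpa using le_dist (D := D) fun k hk => (h j).ge hij le_rfl hk⟩

theorem RayOrAntiRay.conn_or (R : RayOrAntiRay D) (i : ℕ) :
    (ofDigraph D).W i (R.seq 0) (R.seq i) ∨ (ofDigraph D).W i (R.seq i) (R.seq 0) := by
  rcases R with R | R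
  · left
    have := chain (X := ofDigraph D) (lam := 1) (g := R.vert) (Nat.zero_le i)
      fun t _ _ => w_one_of_adj (R.adj t)
    rw [one_mul] at this
    exact this
  · right
    have := chain (X := (ofDigraph D).rev) (lam := 1) (g := R.vert) (Nat.zero_le i)
      fun t _ _ => w_one_of_adj (R.adj t)
    rw [one_mul] at this
    exact this

/-- A finite set meets `R₁` in an initial segment's worth of vertices, all in the out-ball (ray) or
in-ball (anti-ray) of a suitable radius around the first vertex. -/
theorem BoundaryLE.ble {R₁ R₂ : RayOrAntiRay D} (h : BoundaryLE R₁ R₂) :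
    (ofDigraph D).BLE (Set.range R₁.seq) (Set.range R₂.seq) := by
  obtain ⟨M, hM⟩ := h
  refine ⟨M, fun F hF => ?_⟩
  have hfin : {i | R₁.seq i ∈ F}.Finite := hF.preimage R₁.seq_injective.injOn
  obtain ⟨N, hN⟩ := hfin.bddAbove
  obtain ⟨P, h1, h2, h3, h4⟩ := hM N (R₁.seq 0)
  rw [RayOrAntiRay.support_eq] at h1 h2
  refine ⟨_, h1, _, h2, fun hmem => ?_, dist_le_iff.2 ⟨P, rfl, rfl, h3⟩⟩
  obtain ⟨i, hi⟩ := h1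
  have hiN : i ≤ N := hN (by rw [Set.mem_ofPred_eq, hi]; exact hmem)
  have hd := Set.disjoint_left.1 h4
  refine hd (a := P.first) ⟨0, Nat.zero_le _, rfl⟩ ?_
  rw [← hi]
  exact (R₁.conn_or i).imp (fun h => (ofDigraph D).mono h hiN) fun h => (ofDigraph D).mono h hiN

theorem boundaryLE_of_ble {R₁ R₂ : RayOrAntiRay D} (hf : (ofDigraph D).FinBalls)
    (h : (ofDigraph D).BLE (Set.range R₁.seq) (Set.range R₂.seq)) : BoundaryLE R₁ R₂ := by
  obtain ⟨M, hM⟩ := h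
  refine ⟨M, fun r x => ?_⟩
  obtain ⟨u, hu, w, hw, hn, hW⟩ := hM _ (hf.into M ((hf r x).1.union (hf r x).2))
  obtain ⟨P, h1, h2, h3⟩ := dist_le_iff.1 hW
  rw [← R₁.support_eq] at hu
  rw [← R₂.support_eq] at hw
  refine ⟨P, h1 ▸ hu, h2 ▸ hw, h3, Set.disjoint_left.2 ?_⟩
  rintro _ ⟨i, hi, rfl⟩ hb
  have hi' : i ≤ P.length := hi
  refine hn ⟨P.vert i, hb, ?_⟩
  have := P.dist_le (Nat.zero_le i) hi'
  rw [show P.vert 0 = u from h1] at this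
  exact this.trans (by norm_cast; omega)

theorem boundaryEquiv_refl (hf : (ofDigraph D).FinBalls) (R : RayOrAntiRay D) :
    BoundaryEquiv R R := by
  have := boundaryLE_of_ble hf (R₁ := R) (R₂ := R) (BLE.of_injective (M := 0) (M' := 0) hf
    R.seq_injective Set.finite_empty (fun t => ⟨_, ⟨t, rfl⟩, StepMetric.refl _ _⟩)
    fun t _ => ⟨_, ⟨t, rfl⟩, StepMetric.refl _ _⟩)
  exact ⟨this, this⟩

theorem EndLE.pathFamily {R₁ R₂ : RayOrAntiRay D} (h : EndLE R₁ R₂) :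
    ∃ v ℓ, (ofDigraph D).PathFamily (Set.range R₁.seq) (Set.range R₂.seq) v ℓ := by
  obtain ⟨P, hP, hd⟩ := h
  refine ⟨fun n => (P n).vert, fun n => (P n).length, fun n i hi => w_one_of_adj ((P n).adj i hi),
    fun n => R₁.support_eq ▸ (hP n).1, fun n => R₂.support_eq ▸ (hP n).2, fun m n hmn i hi j hj e => ?_⟩
  exact Set.disjoint_left.1 (hd m n hmn) ⟨i, hi, rfl⟩ ⟨j, hj, e.symm⟩

theorem endLE_refl (R : RayOrAntiRay D) : EndLE R R := by
  refine ⟨fun n => ⟨0, fun _ => R.seq n, by simp⟩, fun n => ?_, fun m n hmn => ?_⟩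
  · rw [R.support_eq]
    exact ⟨⟨n, rfl⟩, ⟨n, rfl⟩⟩
  · rw [Set.disjoint_left]
    rintro _ ⟨i, _, rfl⟩ ⟨j, _, e⟩
    exact hmn (R.seq_injective e.symm)

theorem IsOneEnded.endEquiv (h : IsOneEnded D) (R Q : RayOrAntiRay D) : EndEquiv R Q := by
  obtain ⟨ω, hω⟩ := Set.encard_eq_one.1 h
  have h1 : {S | EndEquiv R S} = ω := by
    rw [← Set.mem_singleton_iff, ← hω]
    exact ⟨R, rfl⟩
  have h2 : {S | EndEquiv Q S} = ω := by
    rw [← Set.mem_singleton_iff, ← hω]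
    exact ⟨Q, rfl⟩
  have : Q ∈ {S | EndEquiv Q S} := ⟨endLE_refl Q, endLE_refl Q⟩
  rwa [h2, ← h1] at this

theorem IsOneEnded.nonempty (h : IsOneEnded D) : Nonempty (RayOrAntiRay D) := by
  obtain ⟨ω, hω⟩ := Set.encard_eq_one.1 h
  obtain ⟨R, _⟩ : ω ∈ ends D := hω ▸ rfl
  exact ⟨R⟩

/-! ### The dichotomy -/

/-- One ray per boundary class of geodesic rays from `o` suffices. The parameter `Y` serves for the
distance and for its reversal. -/
theorem finRays_of_finite {Y : StepMetric V} (hf : (ofDigraph D).FinBalls)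
    (hfin : (boundary D).Finite) (q : ∀ ρ, Y.GeoRay ρ → QuasiGeodesicRay D)
    (hq : ∀ ρ ρ' (h : Y.GeoRay ρ) (h' : Y.GeoRay ρ'), BoundaryEquiv (q ρ h).1 (q ρ' h').1 →
      Y.BLE (Set.range ρ) (Set.range ρ')) (o : V) : Y.FinRays o := by
  classical
  let f : (ℕ → V) → Set (QuasiGeodesicRay D) := fun ρ =>
    if h : Y.GeoRay ρ then {Q | BoundaryEquiv (q ρ h).1 Q.1} else ∅
  have hfT : (f '' {ρ | Y.GeoRay ρ ∧ ρ 0 = o}).Finite := by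
    refine hfin.subset ?_
    rintro _ ⟨ρ, ⟨hρ, _⟩, rfl⟩
    exact ⟨q ρ hρ, by simp [f, hρ]⟩
  obtain ⟨s, hsub, hs, himg⟩ := Set.Finite.exists_subset_finite_image_eq hfT subset_rfl
  refine ⟨s, hs, fun ρ hρ => hsub hρ, fun ξ hξ h0 => ?_⟩
  have : f ξ ∈ f '' s := by
    rw [himg]
    exact ⟨ξ, ⟨hξ, h0⟩, rfl⟩
  obtain ⟨ρ, hρ, e⟩ := this
  have hρr : Y.GeoRay ρ := (hsub hρ).1
  refine ⟨ρ, hρ, hq ρ ξ hρr hξ ?_⟩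
  have hmem : q ξ hξ ∈ f ξ := by simpa [f, hξ] using boundaryEquiv_refl hf _
  rw [← e] at hmem
  simpa [f, hρr] using hmem

theorem boundary_dichotomy {δ C : ℕ} (h : (ofDigraph D).IsHyp δ C)
    (hf : (ofDigraph D).FinBalls) (hone : IsOneEnded D) :
    (boundary D).encard = 1 ∨ (boundary D).Infinite := by
  rw [or_iff_not_imp_right, Set.not_infinite]
  intro hfin
  have fin : ∀ o, (ofDigraph D).FinRays o := finRays_of_finite hf hfin (fun ρ h => ofGeoRay h)
    fun ρ ρ' h h' he => he.1.ble
  have fin' : ∀ o, (ofDigraph D).rev.FinRays o := finRays_of_finite hf hfin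
    (fun ρ h => ofRevGeoRay h) fun ρ ρ' h h' he => he.2.ble.reverse hf
  have hle : ∀ R Q : QuasiGeodesicRay D, BoundaryLE R.1 Q.1 := by
    rintro ⟨R, hR⟩ ⟨Q, hQ⟩
    obtain ⟨v, ℓ, hv⟩ := (hone.endEquiv R Q).1.pathFamily
    refine boundaryLE_of_ble hf ?_
    rcases R with R | R <;> rcases Q with Q | Q
    · obtain ⟨γ, c, q⟩ := Ray.quasiRay hR
      obtain ⟨γ', c', q'⟩ := Ray.quasiRay hQ
      exact h.ble_of_pathFamily hf q (Or.inl q') (fin _) hv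
    · obtain ⟨γ, c, q⟩ := Ray.quasiRay hR
      obtain ⟨γ', c', q'⟩ := AntiRay.quasiRay hQ
      exact h.ble_of_pathFamily hf q (Or.inr q') (fin _) hv
    · obtain ⟨γ, c, q⟩ := AntiRay.quasiRay hR
      obtain ⟨γ', c', q'⟩ := Ray.quasiRay hQ
      -- No base vertex on the anti-ray reaches all of it, so short paths are found from `Q` to `R`;
      -- one path from `R` to `Q` then allows turning them around.
      obtain ⟨v', ℓ', hv'⟩ := (hone.endEquiv (.inr R) (.inl Q)).2.pathFamily
      have hb := h.ble_of_pathFamily hf q' (Or.inr q) (fin _) hv'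
      obtain ⟨a, ha⟩ := hv.first 0
      obtain ⟨b, hb'⟩ := hv.last 0
      have hc := hv.conn 0
      rw [← ha, ← hb'] at hc
      exact h.ble_symm hf q q' hc hb
    · obtain ⟨γ, c, q⟩ := AntiRay.quasiRay hR
      obtain ⟨γ', c', q'⟩ := AntiRay.quasiRay hQ
      exact (h.reverse.ble_of_pathFamily hf.reverse q' (Or.inl q) (fin' _) hv.reverse).reverse
        hf.reverse
  obtain ⟨R⟩ : Nonempty (QuasiGeodesicRay D) := by
    obtain ⟨R | R⟩ := hone.nonempty
    · obtain ⟨ξ, hξ⟩ := exists_geoRay hf R.inj fun i => w_one_of_adj (R.adj i)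
      exact ⟨ofGeoRay hξ⟩
    · obtain ⟨ξ, hξ⟩ := exists_geoRay hf.reverse R.inj fun i => w_one_of_adj (R.adj i)
      exact ⟨ofRevGeoRay hξ⟩
  refine Set.encard_eq_one.2 ⟨Set.univ, Set.eq_singleton_iff_unique_mem.2 ⟨⟨R, ?_⟩, ?_⟩⟩
  · exact Set.ext fun Q => ⟨fun _ => ⟨hle R Q, hle Q R⟩, fun _ => trivial⟩
  · rintro _ ⟨R', rfl⟩
    exact Set.ext fun Q => ⟨fun _ => trivial, fun _ => ⟨hle R' Q, hle Q R'⟩⟩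

/-! ### Semigroups -/

theorem exists_ball_card {X : StepMetric V} {N₁ : ℕ}
    (h : ∀ x, ∃ b : Finset V, b.card ≤ N₁ ∧ ∀ y, X.W 1 x y → y ∈ b) (k : ℕ) :
    ∃ N, ∀ x, ∃ b : Finset V, b.card ≤ N ∧ ∀ y, X.W k x y → y ∈ b := by
  classical
  induction k with
  | zero => exact ⟨1, fun x => ⟨{x}, by simp, fun y hy => by simp [X.eq_of_zero hy]⟩⟩
  | succ k ih =>
    obtain ⟨N, hN⟩ := ih
    choose c hc hc' using h
    refine ⟨N * N₁, fun x => ?_⟩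
    obtain ⟨b, hb, hb'⟩ := hN x
    refine ⟨b.biUnion c, ?_, fun y hy => ?_⟩
    · exact (Finset.card_biUnion_le_card_mul _ _ _ fun z _ => hc z).trans (Nat.mul_le_mul_right _ hb)
    · obtain ⟨z, h1, h2⟩ := X.split hy
      exact Finset.mem_biUnion.2 ⟨z, hb' z h1, hc' z y h2⟩

section Cayley

variable {S : Type*} [Semigroup S]

theorem cayley_out_card {A : Set S} (hA : A.Finite) : ∃ N, ∀ x, ∃ b : Finset S, b.card ≤ N ∧
    ∀ y, (ofDigraph (cayley A)).W 1 x y → y ∈ b := by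
  classical
  refine ⟨hA.toFinset.card + 1, fun x => ⟨insert x (hA.toFinset.image (x * ·)), ?_, fun y hy => ?_⟩⟩
  · exact (Finset.card_insert_le _ _).trans (Nat.add_le_add_right Finset.card_image_le _)
  · rcases eq_or_adj_of_w_one hy with rfl | ⟨a, ha, rfl⟩
    · simp
    · exact Finset.mem_insert_of_mem (Finset.mem_image_of_mem _ (by simpa using ha))

/-- By right cancellation `y * a = x` determines `y`, so each generator contributes at most one
in-neighbour. -/
theorem cayley_in_card [IsRightCancelMul S] {A : Set S} (hA : A.Finite) :
    ∃ N, ∀ x, ∃ b : Finset S, b.card ≤ N ∧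
      ∀ y, (ofDigraph (cayley A)).rev.W 1 x y → y ∈ b := by
  classical
  have : ∀ x a : S, ∃ z, ∀ y, y * a = x → y = z := by
    intro x a
    by_cases h : ∃ z, z * a = x
    · obtain ⟨z, hz⟩ := h
      exact ⟨z, fun y hy => mul_right_cancel (hy.trans hz.symm)⟩
    · exact ⟨x, fun y hy => absurd ⟨y, hy⟩ h⟩
  choose f hf using this
  refine ⟨hA.toFinset.card + 1, fun x => ⟨insert x (hA.toFinset.image (f x)), ?_, fun y hy => ?_⟩⟩
  · exact (Finset.card_insert_le _ _).trans (Nat.add_le_add_right Finset.card_image_le _)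
  · rcases eq_or_adj_of_w_one hy with rfl | ⟨a, ha, e⟩
    · simp
    · refine Finset.mem_insert_of_mem (Finset.mem_image.2 ⟨a, by simpa using ha, ?_⟩)
      exact (hf x a y e.symm).symm

theorem cayley_finBalls [IsRightCancelMul S] {A : Set S} (hA : A.Finite) :
    (ofDigraph (cayley A)).FinBalls := by
  obtain ⟨_, h1⟩ := cayley_out_card hA
  obtain ⟨_, h2⟩ := cayley_in_card hA
  refine fun k x => ⟨finBalls_of_one (fun x => ?_) k x,
    finBalls_of_one (X := (ofDigraph (cayley A)).rev) (fun x => ?_) k x⟩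
  · obtain ⟨b, _, hb⟩ := h1 x
    exact b.finite_toSet.subset hb
  · obtain ⟨b, _, hb⟩ := h2 x
    exact b.finite_toSet.subset hb

theorem cayley_isHyp [IsRightCancelMul S] {A : Set S} (hA : A.Finite) {δ : ℕ}
    (h : (ofDigraph (cayley A)).Hyp δ) : ∃ C, (ofDigraph (cayley A)).IsHyp δ C := by
  obtain ⟨_, h1⟩ := cayley_out_card hA
  obtain ⟨_, h2⟩ := cayley_in_card hA
  obtain ⟨N₁, h1⟩ := exists_ball_card h1 δ
  obtain ⟨N₂, h2⟩ := exists_ball_card h2 δ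
  refine ⟨_, h.isHyp (F := max N₁ N₂) (fiberBound_of_card fun x => ?_) (fiberBound_of_card fun x => ?_)⟩
  · obtain ⟨b, hb, hb'⟩ := h1 x
    exact ⟨b, hb.trans (le_max_left _ _), hb'⟩
  · obtain ⟨b, hb, hb'⟩ := h2 x
    exact ⟨b, hb.trans (le_max_right _ _), hb'⟩

theorem cayley_dist_mul {B : Set S} (hB : IsFiniteGeneratingSet B) (s : S) :
    ∃ k, ∀ x, (ofDigraph (cayley B)).W k x (x * s) := by
  have hs : s ∈ Subsemigroup.closure B := hB.2 ▸ Subsemigroup.mem_top s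
  induction hs using Subsemigroup.closure_induction with
  | mem a ha => exact ⟨1, fun x => w_one_of_adj ⟨a, ha, rfl⟩⟩
  | mul a b _ _ iha ihb =>
    obtain ⟨k, hk⟩ := iha
    obtain ⟨l, hl⟩ := ihb
    exact ⟨k + l, fun x => (ofDigraph (cayley B)).trans (hk x) (by simpa [mul_assoc] using hl (x * a))⟩

theorem cayley_lipschitz {A B : Set S} (hA : A.Finite) (hB : IsFiniteGeneratingSet B) :
    ∃ lam, ∀ {k x y}, (ofDigraph (cayley A)).W k x y → (ofDigraph (cayley B)).W (lam * k) x y := by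
  choose f hf using cayley_dist_mul hB
  refine ⟨hA.toFinset.sup f, fun {k x y} h => ?_⟩
  obtain ⟨g, rfl, rfl, hg⟩ := exists_path h
  have := chain (X := ofDigraph (cayley B)) (lam := hA.toFinset.sup f) (g := g) (Nat.zero_le k)
    fun t _ ht => by
      rcases eq_or_adj_of_w_one (hg t ht) with e | ⟨a, ha, e⟩
      · rw [← e]
        exact StepMetric.mono _ (StepMetric.refl _ _) (Nat.zero_le _)
      · rw [e]
        exact StepMetric.mono _ (hf a _) (Finset.le_sup (f := f) (by simpa using ha))
  simpa using this

end Cayley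

end DigraphBoundary

theorem mainTheorem11 :
    (∀ {V : Type*} (D : Digraph V),
      DigraphBoundary.IsLocallyFinite D →
      DigraphBoundary.IsHyperbolic D →
      DigraphBoundary.BoundedOutBalls D →
      DigraphBoundary.BoundedInBalls D →
      DigraphBoundary.IsFinitelyBased D →
      DigraphBoundary.IsOneEnded D →
      (DigraphBoundary.boundary D).encard = 1 ∨ (DigraphBoundary.boundary D).Infinite) ∧
    (∀ {S : Type*} [Semigroup S] [IsRightCancelMul S],
      DigraphBoundary.IsHyperbolicSemigroup S →
      ∀ A : Set S, DigraphBoundary.IsFiniteGeneratingSet A →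
      DigraphBoundary.IsOneEnded (DigraphBoundary.cayley A) →
      (DigraphBoundary.boundary (DigraphBoundary.cayley A)).encard = 1 ∨
        (DigraphBoundary.boundary (DigraphBoundary.cayley A)).Infinite) := by
  refine ⟨fun {V} D hlf ⟨δ, hδ⟩ h1 h2 _ hone => ?_, fun {S} _ _ ⟨B, hB, δ, hδ⟩ A hA hone => ?_⟩
  · obtain ⟨C, hC⟩ := hδ.isHyp h1 h2
    exact DigraphBoundary.boundary_dichotomy hC hlf.finBalls hone
  · obtain ⟨C, hC⟩ := DigraphBoundary.cayley_isHyp hB.1 hδ.hyp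
    obtain ⟨l₁, hl₁⟩ := DigraphBoundary.cayley_lipschitz hA.1 hB
    obtain ⟨l₂, hl₂⟩ := DigraphBoundary.cayley_lipschitz hB.1 hA
    -- Hyperbolicity is given for `B` only; the two word distances bound each other up to a factor.
    obtain ⟨δ', hδ'⟩ := hC.transfer (lam := max l₁ l₂)
      (fun h => DigraphBoundary.StepMetric.mono _ (hl₁ h) (Nat.mul_le_mul_right _ (le_max_left _ _)))
      (fun h => DigraphBoundary.StepMetric.mono _ (hl₂ h) (Nat.mul_le_mul_right _ (le_max_right _ _)))
    obtain ⟨C', hC'⟩ := DigraphBoundary.cayley_isHyp hA.1 hδ'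
    exact DigraphBoundary.boundary_dichotomy hC' (DigraphBoundary.cayley_finBalls hA.1) hone
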